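/- Let $p$ be a prime number and let $K=\mathbb{Q}(\sqrt{p})$, with ring of integers $\mathcal{O}_K=\mathbb{Z}[\alpha]$, where $\alpha=\frac{1+\sqrt{p}}{2}$ if $p\equiv 1\pmod 4$ and $\alpha=\sqrt{p}$ otherwise. For an integer $n\ge 1$ let $R_n=\mathbb{Z}[n\alpha]$ be the order of index $n$ in $K$. An order $R$ in $K$ with conductor $I=\{x\in R : x\mathcal{O}_K\subseteq R\}$ is called locally associated if the groups $U(\mathcal{O}_K)/U(R)$ and $U(\mathcal{O}_K/I)/U(R/I)$ are isomorphic, where $U(\cdot)$ denotes the group of units. The following orders are locally associated: 1. $R_2$, if $p\not\equiv 5\pmod 8$; 2. $R_4$, if $p\equiv 1\pmod 8$; 3. $R_3$, if $p\not\equiv 3\pmod 4$. The following equivalences hold: 4. $R_{p^k}$ is locally associated for every integer $k\ge 1$ if and only if $R_p$ is locally associated; 5. if $p\equiv 5\pmod 8$, then $R_4$ is locally associated if and only if $R_2$ is locally associated; 6. if $q\ne p$ is an odd prime, then $R_{q^k}$ is locally associated for every integer $k\ge 1$ if and only if $R_{q^2}$ is locally associated. The following orders are not locally associated: 7. $R_{q^k}$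 for every odd prime $q\neq p$ and every integer $k\ge 1$, if $p\equiv 3\pmod 4$ or $q\equiv 1\pmod 4$; 8. $R_4$, if $p\equiv 3\pmod 4$; 9. $R_8$, if $p$ is odd. -/

import Mathlib

open scoped NumberField

noncomputable section

/-- The conductor `(R : S) = {x ∈ R | x S ⊆ R}` of a subring `R` of `S`, as an ideal of `S`. -/
def orderConductor {S : Type*} [CommRing S] (R : Subalgebra ℤ S) : Ideal S where
  carrier := {x | x ∈ R ∧ ∀ y : S, x * y ∈ R}
  add_mem' := by
    rintro a b ⟨ha, ha'⟩ ⟨hb, hb'⟩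
    exact ⟨R.add_mem ha hb, fun y => by rw [add_mul]; exact R.add_mem (ha' y) (hb' y)⟩
  zero_mem' := ⟨R.zero_mem, fun y => by rw [zero_mul]; exact R.zero_mem⟩
  smul_mem' := by
    rintro c x ⟨_, hx'⟩
    refine ⟨by rw [smul_eq_mul, mul_comm]; exact hx' c, fun y => ?_⟩
    rw [smul_eq_mul, mul_comm c x, mul_assoc]
    exact hx' (c * y)

/-- The conductor of `R` in `S`, viewed as an ideal of `R`. -/
def orderConductor' {S : Type*} [CommRing S] (R : Subalgebra ℤ S) : Ideal R :=
  (orderConductor R).comap (algebraMap R S)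

/-- The inclusion of unit groups `U(R) → U(S)`. -/
def unitsInclusion {S : Type*} [CommRing S] (R : Subalgebra ℤ S) : (R : Type _)ˣ →* Sˣ :=
  Units.map (algebraMap R S : R →* S)

/-- The map of unit groups `U(R/I) → U(S/I)` induced by the inclusion `R ⊆ S`, where `I` is the
conductor of `R` in `S`. -/
def unitsQuotientInclusion {S : Type*} [CommRing S] (R : Subalgebra ℤ S) :
    (R ⧸ orderConductor' R)ˣ →* (S ⧸ orderConductor R)ˣ :=
  Units.map (Ideal.quotientMap (I := orderConductor' R) (orderConductor R)
    (algebraMap R S) le_rfl).toMonoidHom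

/-- An order `R` of the number field `K`, with integral closure `S = 𝓞 K` and conductor `I`,
is locally associated if `U(S)/U(R)` and `U(S/I)/U(R/I)` are isomorphic groups. -/
def IsLocallyAssociated {K : Type*} [Field K] (R : Subalgebra ℤ (𝓞 K)) : Prop :=
  Nonempty (((𝓞 K)ˣ ⧸ (unitsInclusion R).range) ≃*
    ((𝓞 K ⧸ orderConductor R)ˣ ⧸ (unitsQuotientInclusion R).range))

/-- The number `α` with `𝓞 K = ℤ[α]` for `K = ℚ(s)`, `s ^ 2 = d` squarefree:
`(1 + s) / 2` if `d ≡ 1 (mod 4)`, and `s` otherwise. -/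
def quadGen {K : Type*} [Field K] (d : ℤ) (s : K) : K :=
  if d % 4 = 1 then (1 + s) / 2 else s

theorem isIntegral_quadGen {K : Type*} [Field K] [NumberField K] {d : ℤ} {s : K}
    (hs : s ^ 2 = (d : K)) : IsIntegral ℤ (quadGen d s) := by
  have hsi : IsIntegral ℤ s := by
    refine IsIntegral.of_pow (n := 2) (by norm_num) ?_
    rw [hs]
    exact isIntegral_algebraMap (R := ℤ) (x := d)
  unfold quadGen
  split_ifs with h
  · obtain ⟨c, hc⟩ : ∃ c : ℤ, d = 4 * c + 1 := ⟨d / 4, by omega⟩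
    refine ⟨Polynomial.X ^ 2 - Polynomial.X - Polynomial.C c, by monicity!, ?_⟩
    have hs' : s ^ 2 = 4 * (c : K) + 1 := by rw [hs, hc]; push_cast; ring
    have h2 : (2 : K) ≠ 0 := two_ne_zero
    simp only [Polynomial.eval₂_sub, Polynomial.eval₂_pow, Polynomial.eval₂_X,
      Polynomial.eval₂_C]
    rw [eq_intCast (algebraMap ℤ K) c]
    field_simp
    linear_combination hs'
  · exact hsi

/-- The generator `α` of `𝓞 K`, as an element of `𝓞 K`. -/
def quadGenInt {K : Type*} [Field K] [NumberField K] (d : ℤ) (s : K) (hs : s ^ 2 = (d : K)) :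
    𝓞 K :=
  ⟨quadGen d s, isIntegral_quadGen hs⟩

/-- The order `R_n = ℤ[n α]` of index `n` in `K = ℚ(s)`, where `s ^ 2 = d`. -/
def quadOrder {K : Type*} [Field K] [NumberField K] (d : ℤ) (s : K) (hs : s ^ 2 = (d : K))
    (n : ℕ) : Subalgebra ℤ (𝓞 K) :=
  Algebra.adjoin ℤ {(n : 𝓞 K) * quadGenInt d s hs}

end

/-! Write `O` for the ring of integers. Reduction modulo the conductor always embeds `U(O)/U(R)` in
`U(O/I)/U(R/I)`, because `I ⊆ R`. The target is finite, so an abstract isomorphism exists exactly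
when this embedding is onto. For `R = R_n` one has `R = ℤ + nO` and `I = nO`, so the condition is
`UnitsCover`: the units of `O` surject onto `C_n = (O/n)ˣ/(ℤ/n)ˣ`.

Positive results: for a prime `q` and `k ≥ 1` the kernel of `C_{q^(k+1)} → C_{q^k}` has order `q`,
and it is generated by any unit whose `ω`-coefficient is divisible by `q^k` exactly
(`UnitsCover.succ`). Taking `q`-th powers raises this exact exponent by one, for odd `q` once `k ≥
1`, and already from `k = 0` when `q = p` (with `q = 2` included if `p = 2`). Hence one covered
level, `q^2` or `p`, yields all of them. Moduli 2, 3 and 4 are handled by hand, with units supplied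
by the equations `a² - p b² = ±1`.

Negative results: an element congruent to `c u`, with `u` a unit, has norm congruent to `± c²`.
Modulo an odd unramified `q` norms take every value, so if unit norms are squares mod `q` the
covering fails. For 4 and 8 an explicit element has norm 5 mod 8, which is not `± c²` for odd `c`.
-/

/-! ### Local association as surjectivity of reduction. -/

/-- The map `U(S)/U(R) → U(S/I)/U(R/I)` induced by reduction modulo the conductor. -/
noncomputable def unitsReduction {S : Type*} [CommRing S] (R : Subalgebra ℤ S) :
    (Sˣ ⧸ (unitsInclusion R).range) →*
      ((S ⧸ orderConductor R)ˣ ⧸ (unitsQuotientInclusion R).range) :=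
  QuotientGroup.map _ _ (Units.map (Ideal.Quotient.mk (orderConductor R)).toMonoidHom) <| by
    rintro _ ⟨v, rfl⟩
    exact ⟨Units.map (Ideal.Quotient.mk (orderConductor' R)).toMonoidHom v, by
      ext; rfl⟩

theorem unitsReduction_mk {S : Type*} [CommRing S] (R : Subalgebra ℤ S) (u : Sˣ) :
    unitsReduction R (QuotientGroup.mk u) =
      QuotientGroup.mk (Units.map (Ideal.Quotient.mk (orderConductor R)).toMonoidHom u) :=
  rfl

/-- The conductor lies inside `R`, so being congruent to an element of `R` modulo it already means
being in `R`. -/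
theorem mem_of_units_reduction_mem {S : Type*} [CommRing S] {R : Subalgebra ℤ S} {u : Sˣ}
    (h : Units.map (Ideal.Quotient.mk (orderConductor R)).toMonoidHom u ∈
      (unitsQuotientInclusion R).range) : (u : S) ∈ R := by
  obtain ⟨v, hv⟩ := h
  obtain ⟨r, hr⟩ := Ideal.Quotient.mk_surjective (v : R ⧸ orderConductor' R)
  have h1 := congrArg Units.val hv
  simp only [unitsQuotientInclusion, Units.coe_map] at h1
  rw [← hr] at h1
  have h2 : Ideal.Quotient.mk (orderConductor R) (r : S) =
      Ideal.Quotient.mk (orderConductor R) (u : S) := h1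
  have h3 := (Ideal.Quotient.eq.mp h2).1
  simpa using R.sub_mem r.2 h3

theorem unitsReduction_injective {S : Type*} [CommRing S] (R : Subalgebra ℤ S) :
    Function.Injective (unitsReduction R) := by
  rw [injective_iff_map_eq_one]
  intro g
  induction g using QuotientGroup.induction_on with
  | H u =>
    intro h
    rw [unitsReduction_mk, QuotientGroup.eq_one_iff] at h
    rw [QuotientGroup.eq_one_iff]
    have h1 := mem_of_units_reduction_mem h
    have h2 : ((u⁻¹ : Sˣ) : S) ∈ R := by
      refine mem_of_units_reduction_mem ?_
      rw [map_inv]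
      exact inv_mem h
    refine ⟨⟨⟨u, h1⟩, ⟨_, h2⟩, ?_, ?_⟩, ?_⟩
    · ext; simp
    · ext; simp
    · ext; rfl

/-- An abstract isomorphism gives equal cardinalities, and an injection between finite sets of equal
size is onto. -/
theorem isLocallyAssociated_iff_surjective {K : Type*} [Field K] (R : Subalgebra ℤ (𝓞 K))
    [Finite (𝓞 K ⧸ orderConductor R)] :
    IsLocallyAssociated R ↔ Function.Surjective (unitsReduction R) := by
  constructor
  · rintro ⟨e⟩
    have hc := Nat.card_congr e.toEquiv
    exact ((Nat.bijective_iff_injective_and_card _).mpr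
      ⟨unitsReduction_injective R, hc⟩).2
  · intro h
    exact ⟨MulEquiv.ofBijective _ ⟨unitsReduction_injective R, h⟩⟩

theorem unitsReduction_surjective_iff {S : Type*} [CommRing S] (R : Subalgebra ℤ S) :
    Function.Surjective (unitsReduction R) ↔
      ∀ x y : S, x * y - 1 ∈ orderConductor R → ∃ u : Sˣ, ∃ r ∈ R, ∃ r' ∈ R,
        r * r' - 1 ∈ orderConductor R ∧ x - r * u ∈ orderConductor R := by
  constructor
  · intro h x y hxy
    have hxy' : Ideal.Quotient.mk (orderConductor R) x * Ideal.Quotient.mk _ y = 1 := by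
      rw [← map_mul, ← map_one (Ideal.Quotient.mk _)]
      exact Ideal.Quotient.eq.mpr hxy
    obtain ⟨g, hg⟩ := h (QuotientGroup.mk ⟨_, _, hxy', by rw [mul_comm]; exact hxy'⟩)
    obtain ⟨u, rfl⟩ := QuotientGroup.mk_surjective g
    rw [unitsReduction_mk, QuotientGroup.eq] at hg
    obtain ⟨v, hv⟩ := hg
    obtain ⟨r, hr⟩ := Ideal.Quotient.mk_surjective (v : R ⧸ orderConductor' R)
    obtain ⟨r', hr'⟩ := Ideal.Quotient.mk_surjective ((v⁻¹ : _ˣ) : R ⧸ orderConductor' R)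
    refine ⟨u, r, r.2, r', r'.2, ?_, ?_⟩
    · have h1 : Ideal.Quotient.mk (orderConductor' R) (r * r') = Ideal.Quotient.mk _ 1 := by
        rw [map_mul, hr, hr', map_one, Units.mul_inv]
      have h2 : r * r' - 1 ∈ orderConductor' R := Ideal.Quotient.eq.mp h1
      exact h2
    · rw [eq_inv_mul_iff_mul_eq] at hv
      have h1 := congrArg Units.val hv
      simp only [unitsQuotientInclusion, Units.val_mul, Units.coe_map] at h1
      rw [← hr] at h1
      have h2 : Ideal.Quotient.mk (orderConductor R) ((u : S) * r) =
          Ideal.Quotient.mk (orderConductor R) x := by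
        rw [map_mul]; exact h1
      rw [mul_comm]
      exact Ideal.Quotient.eq.mp h2.symm
  · intro h g
    obtain ⟨w, rfl⟩ := QuotientGroup.mk_surjective g
    obtain ⟨x, hx⟩ := Ideal.Quotient.mk_surjective (w : S ⧸ orderConductor R)
    obtain ⟨y, hy⟩ := Ideal.Quotient.mk_surjective ((w⁻¹ : _ˣ) : S ⧸ orderConductor R)
    obtain ⟨u, r, hr, r', hr', h1, h2⟩ := h x y (Ideal.Quotient.eq.mp (by
      rw [map_mul, hx, hy, map_one, Units.mul_inv]))
    have h3 : Ideal.Quotient.mk (orderConductor' R) ⟨r, hr⟩ *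
        Ideal.Quotient.mk (orderConductor' R) ⟨r', hr'⟩ = 1 := by
      rw [← map_mul, ← map_one (Ideal.Quotient.mk _)]
      exact Ideal.Quotient.eq.mpr h1
    refine ⟨QuotientGroup.mk u, ?_⟩
    rw [unitsReduction_mk, QuotientGroup.eq]
    refine ⟨⟨_, _, h3, by rw [mul_comm]; exact h3⟩, ?_⟩
    rw [eq_inv_mul_iff_mul_eq]
    ext
    rw [← hx]
    change Ideal.Quotient.mk (orderConductor R) (u : S) * Ideal.Quotient.mk (orderConductor R) r = _
    rw [← map_mul, mul_comm]
    exact (Ideal.Quotient.eq.mpr h2).symm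

/-! ### The covering condition in `ℤ[ω]`. -/

open QuadraticAlgebra in
/-- Every element of `ℤ[ω]`, `ω ^ 2 = M + T ω`, with norm prime to `n` is congruent modulo `n` to
an integral multiple of a unit. -/
def UnitsCover (M T n : ℤ) : Prop :=
  ∀ x : QuadraticAlgebra ℤ M T, IsCoprime x.norm n →
    ∃ (u : (QuadraticAlgebra ℤ M T)ˣ) (c : ℤ), (n : QuadraticAlgebra ℤ M T) ∣ x - c * u

namespace QuadraticAlgebra

variable {M T : ℤ}

theorem intCast_dvd_iff {n : ℤ} {z : QuadraticAlgebra ℤ M T} :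
    (n : QuadraticAlgebra ℤ M T) ∣ z ↔ n ∣ z.re ∧ n ∣ z.im :=
  algebraMap_dvd_iff

theorem intCast_dvd_norm_sub {n : ℤ} {x y : QuadraticAlgebra ℤ M T}
    (h : (n : QuadraticAlgebra ℤ M T) ∣ x - y) : n ∣ x.norm - y.norm := by
  obtain ⟨⟨a, ha⟩, b, hb⟩ := intCast_dvd_iff.mp h
  simp only [re_sub, im_sub] at ha hb
  rw [norm_def, norm_def, show x.re = y.re + n * a by linarith, show x.im = y.im + n * b by linarith]
  refine ⟨2 * y.re * a + n * a ^ 2 + T * y.re * b + T * a * y.im + T * a * b * n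
    - M * (2 * y.im * b + n * b ^ 2), ?_⟩
  ring

/-- The conjugate of `x`, times an inverse of its norm modulo `n`, inverts `x`. So coprimality of
the norm encodes being a unit modulo `n`. -/
theorem isCoprime_norm_iff {n : ℤ} {x : QuadraticAlgebra ℤ M T} :
    IsCoprime x.norm n ↔ ∃ y, (n : QuadraticAlgebra ℤ M T) ∣ x * y - 1 := by
  constructor
  · rintro ⟨a, b, h⟩
    refine ⟨a * star x, -b, ?_⟩
    have h1 := algebraMap_norm_eq_mul_star x
    have h2 : ((a * x.norm + b * n : ℤ) : QuadraticAlgebra ℤ M T) = 1 := by rw [h]; simp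
    push_cast at h2
    rw [show algebraMap ℤ (QuadraticAlgebra ℤ M T) (norm x) = (norm x : ℤ) from rfl] at h1
    linear_combination h2 - a * h1
  · rintro ⟨y, hy⟩
    obtain ⟨c, hc⟩ := intCast_dvd_norm_sub hy
    rw [map_mul, norm_one] at hc
    exact ⟨y.norm, -c, by linear_combination hc⟩

end QuadraticAlgebra

/-! ### From the orders `R_n` to the covering condition. -/

section bridge

open QuadraticAlgebra

variable {K : Type*} [Field K] [NumberField K] {d : ℤ} {s : K} {hs : s ^ 2 = (d : K)} {M T : ℤ}

theorem mem_quadOrder_iff (e : QuadraticAlgebra ℤ M T ≃+* 𝓞 K)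
    (he : e ω = quadGenInt d s hs) {n : ℕ} {x : QuadraticAlgebra ℤ M T} :
    e x ∈ quadOrder d s hs n ↔ (n : ℤ) ∣ x.im := by
  have hx : ∀ x : QuadraticAlgebra ℤ M T, e x = x.re + x.im * quadGenInt d s hs := by
    intro x
    rw [← he, ← map_intCast e x.re, ← map_intCast e x.im, ← map_mul, ← map_add]
    congr 1
    ext <;> simp
  constructor
  · intro h
    have key : ∀ y ∈ quadOrder d s hs n, (n : ℤ) ∣ (e.symm y).im := by
      intro y hy
      induction hy using Algebra.adjoin_induction with
      | mem z hz =>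
        rw [Set.mem_singleton_iff.mp hz, ← he]
        simp
      | algebraMap r => simp
      | add y z _ _ hy hz => simpa using dvd_add hy hz
      | mul y z _ _ hy hz =>
        rw [map_mul, im_mul]
        exact dvd_add (dvd_add (hz.mul_left _) (hy.mul_right _))
          ((hy.mul_left _).mul_right _)
    simpa using key _ h
  · rintro ⟨k, hk⟩
    rw [hx, hk]
    have h1 : (n : 𝓞 K) * quadGenInt d s hs ∈ quadOrder d s hs n :=
      Algebra.subset_adjoin (Set.mem_singleton _)
    have : ((x.re : ℤ) : 𝓞 K) + ((n * k : ℤ) : 𝓞 K) * quadGenInt d s hs =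
        x.re + k * (n * quadGenInt d s hs) := by push_cast; ring
    rw [this]
    exact add_mem (intCast_mem _ _) (mul_mem (intCast_mem _ _) h1)

theorem mem_orderConductor_quadOrder_iff (e : QuadraticAlgebra ℤ M T ≃+* 𝓞 K)
    (he : e ω = quadGenInt d s hs) {n : ℕ}
    {x : QuadraticAlgebra ℤ M T} :
    e x ∈ orderConductor (quadOrder d s hs n) ↔ ((n : ℤ) : QuadraticAlgebra ℤ M T) ∣ x := by
  rw [intCast_dvd_iff]
  constructor
  · rintro ⟨h1, h2⟩
    have h3 := h2 (e ω)
    rw [← map_mul, mem_quadOrder_iff e he] at h3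
    rw [mem_quadOrder_iff e he] at h1
    refine ⟨?_, h1⟩
    simp only [im_mul, omega_re, omega_im, mul_one, mul_zero, add_zero] at h3
    exact (dvd_add_left (h1.mul_left _)).mp h3
  · rintro ⟨h1, h2⟩
    refine ⟨(mem_quadOrder_iff e he).mpr h2, fun y => ?_⟩
    obtain ⟨y, rfl⟩ := e.surjective y
    rw [← map_mul, mem_quadOrder_iff e he, im_mul]
    exact dvd_add (dvd_add (h1.mul_right _) (h2.mul_right _)) ((h2.mul_left _).mul_right _)

/-- Modulo `nO` every element of `R_n` is congruent to an integer, so the factor from `R` can be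
taken in `ℤ`. Its coprimality to `n` need not be imposed: comparing norms forces it. -/
theorem isLocallyAssociated_quadOrder_iff (e : QuadraticAlgebra ℤ M T ≃+* 𝓞 K)
    (he : e ω = quadGenInt d s hs) {n : ℕ} (hn : 1 ≤ n) :
    IsLocallyAssociated (quadOrder d s hs n) ↔ UnitsCover M T n := by
  have hne : orderConductor (quadOrder d s hs n) ≠ ⊥ := by
    intro h
    have h1 : e (n : ℤ) ∈ orderConductor (quadOrder d s hs n) :=
      (mem_orderConductor_quadOrder_iff e he).mpr dvd_rfl
    rw [h, Ideal.mem_bot, map_intCast] at h1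
    have : (n : ℤ) = 0 := by exact_mod_cast h1
    omega
  have : Finite (𝓞 K ⧸ orderConductor (quadOrder d s hs n)) :=
    Ideal.finiteQuotientOfFreeOfNeBot _ hne
  rw [isLocallyAssociated_iff_surjective, unitsReduction_surjective_iff]
  constructor
  · intro h x hx
    obtain ⟨y, hy⟩ := isCoprime_norm_iff.mp hx
    obtain ⟨u, r, hr, r', hr', h1, h2⟩ := h (e x) (e y) (by
      rw [← map_mul, ← map_one e, ← map_sub]
      exact (mem_orderConductor_quadOrder_iff e he).mpr hy)
    obtain ⟨r, rfl⟩ := e.surjective r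
    rw [mem_quadOrder_iff e he] at hr
    refine ⟨Units.map e.symm.toMonoidHom u, r.re, ?_⟩
    obtain ⟨v, hv⟩ := e.surjective (u : 𝓞 K)
    have hv' : ((Units.map e.symm.toMonoidHom u : _ˣ) : QuadraticAlgebra ℤ M T) = v := by
      simp [← hv]
    rw [hv']
    rw [← hv, ← map_mul, ← map_sub, mem_orderConductor_quadOrder_iff e he] at h2
    have h3 : ((n : ℤ) : QuadraticAlgebra ℤ M T) ∣ r - r.re :=
      intCast_dvd_iff.mpr ⟨by simp, by simpa using hr⟩
    have h4 : x - r.re * v = (x - r * v) + (r - r.re) * v := by ring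
    rw [h4]
    exact dvd_add h2 (h3.mul_right _)
  · intro h x y hxy
    obtain ⟨x, rfl⟩ := e.surjective x
    obtain ⟨y, rfl⟩ := e.surjective y
    rw [← map_mul, ← map_one e, ← map_sub, mem_orderConductor_quadOrder_iff e he] at hxy
    have hx := isCoprime_norm_iff.mpr ⟨y, hxy⟩
    obtain ⟨u, c, hu⟩ := h x hx
    obtain ⟨k, hk⟩ := intCast_dvd_norm_sub hu
    have hc : IsCoprime c n := by
      rw [map_mul, norm_intCast, Int.cast_id] at hk
      rw [show x.norm = c ^ 2 * norm (u : QuadraticAlgebra ℤ M T) + n * k by linarith] at hx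
      have h1 := hx.of_add_mul_left_left
      exact (IsCoprime.pow_left_iff (by norm_num)).mp h1.of_mul_left_left
    obtain ⟨a, b, hab⟩ := hc
    refine ⟨Units.map e.toMonoidHom u, e c, (mem_quadOrder_iff e he).mpr (by simp), e a,
      (mem_quadOrder_iff e he).mpr (by simp), ?_, ?_⟩
    · rw [← map_mul, ← map_one e, ← map_sub, mem_orderConductor_quadOrder_iff e he]
      refine ⟨-b, ?_⟩
      have h2 : ((a * c + b * n : ℤ) : QuadraticAlgebra ℤ M T) = 1 := by rw [hab]; simp
      push_cast at h2 ⊢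
      linear_combination h2
    · have : ((Units.map e.toMonoidHom u : (𝓞 K)ˣ) : 𝓞 K) = e u := rfl
      rw [this, ← map_mul, ← map_sub, mem_orderConductor_quadOrder_iff e he]
      exact hu

end bridge

/-! ### The ring of integers of `ℚ(√p)`. -/

section quadraticField

open QuadraticAlgebra

theorem rat_sq_ne_prime {p : ℕ} (hp : p.Prime) (q : ℚ) : q ^ 2 ≠ p := by
  intro h
  have h1 : IsSquare (p : ℚ) := ⟨q, by rw [← h]; ring⟩
  rw [Rat.isSquare_natCast_iff] at h1
  exact hp.prime.not_isSquare h1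

theorem eq_zero_of_sq_eq_prime_mul_sq {p : ℕ} (hp : p.Prime) {a b : ℚ} (h : a ^ 2 = p * b ^ 2) :
    a = 0 ∧ b = 0 := by
  by_cases hb : b = 0
  · subst hb; simpa using h
  · refine absurd ?_ (rat_sq_ne_prime hp (a / b))
    field_simp
    linarith

theorem exists_int_of_isIntegral {q : ℚ} (h : IsIntegral ℤ q) : ∃ n : ℤ, (n : ℚ) = q :=
  IsIntegrallyClosed.isIntegral_iff.mp h

theorem exists_int_of_prime_mul_sq {p : ℕ} (hp : p.Prime) {w : ℚ} {k : ℤ}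
    (h : (p : ℚ) * w ^ 2 = k) : ∃ n : ℤ, (n : ℚ) = w := by
  obtain ⟨v, hv⟩ : ∃ v : ℤ, (v : ℚ) = p * w := by
    refine exists_int_of_isIntegral (IsIntegral.of_pow (n := 2) (by norm_num) ?_)
    rw [show ((p : ℚ) * w) ^ 2 = ((p * k : ℤ) : ℚ) by push_cast; rw [← h]; ring]
    exact isIntegral_algebraMap (R := ℤ) (x := (p * k : ℤ))
  have h1 : v ^ 2 = p * k := by
    have : (v : ℚ) ^ 2 = p * k := by rw [hv, ← h]; ring
    exact_mod_cast this
  obtain ⟨n, hn⟩ := (Nat.prime_iff_prime_int.mp hp).dvd_of_dvd_pow ⟨k, h1⟩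
  refine ⟨n, ?_⟩
  have hp0 : (p : ℚ) ≠ 0 := by exact_mod_cast hp.ne_zero
  apply mul_left_cancel₀ hp0
  rw [← hv, hn]
  push_cast
  ring

variable {K : Type*} [Field K] [NumberField K]

theorem exists_rat_add_rat_mul {d : ℤ} {s : K} (hs : s ^ 2 = (d : K))
    (hK : IntermediateField.adjoin ℚ {s} = ⊤) (x : K) : ∃ a b : ℚ, x = a + b * s := by
  have h1 : Algebra.adjoin ℚ {s} = ⊤ := by
    have := IntermediateField.adjoin_simple_toSubalgebra_of_isAlgebraic
      (F := ℚ) (Algebra.IsAlgebraic.isAlgebraic s)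
    rw [← this, hK]; rfl
  have hx : x ∈ Algebra.adjoin ℚ {s} := by rw [h1]; trivial
  induction hx using Algebra.adjoin_induction with
  | mem z hz => exact ⟨0, 1, by rw [Set.mem_singleton_iff.mp hz]; simp⟩
  | algebraMap r => exact ⟨r, 0, by simp⟩
  | add y z _ _ hy hz =>
    obtain ⟨a, b, rfl⟩ := hy
    obtain ⟨a', b', rfl⟩ := hz
    exact ⟨a + a', b + b', by push_cast; ring⟩
  | mul y z _ _ hy hz =>
    obtain ⟨a, b, rfl⟩ := hy
    obtain ⟨a', b', rfl⟩ := hz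
    refine ⟨a * a' + b * b' * d, a * b' + b * a', ?_⟩
    push_cast
    linear_combination (b : K) * b' * hs

theorem eq_zero_of_rat_add_rat_mul {p : ℕ} (hp : p.Prime) {s : K} (hs : s ^ 2 = ((p : ℤ) : K))
    {a b : ℚ} (h : (a : K) + b * s = 0) : a = 0 ∧ b = 0 := by
  apply eq_zero_of_sq_eq_prime_mul_sq hp
  have : (a : K) ^ 2 = p * b ^ 2 := by
    push_cast at hs
    linear_combination (a - b * s) * h + (b : K) ^ 2 * hs
  exact_mod_cast this

/-- The field `ℚ(√p)` as a quadratic algebra. -/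
theorem exists_ringEquiv_quadraticAlgebra_rat {p : ℕ} (hp : p.Prime) {s : K}
    (hs : s ^ 2 = ((p : ℤ) : K)) (hK : IntermediateField.adjoin ℚ {s} = ⊤) :
    ∃ f : QuadraticAlgebra ℚ (p : ℚ) 0 ≃+* K, ∀ x, f x = x.re + x.im * s := by
  have hss : s * s = (p : ℚ) • (1 : K) + (0 : ℚ) • s := by
    rw [← sq, hs, Algebra.smul_def]; simp
  let g : QuadraticAlgebra ℚ (p : ℚ) 0 →ₐ[ℚ] K := lift ⟨s, hss⟩
  have hg : ∀ x, g x = x.re + x.im * s := by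
    intro x
    simp [g, lift, Algebra.smul_def]
  refine ⟨RingEquiv.ofBijective g.toRingHom ⟨?_, ?_⟩, hg⟩
  · rw [injective_iff_map_eq_zero]
    intro x hx
    obtain ⟨h1, h2⟩ := eq_zero_of_rat_add_rat_mul hp hs ((hg x).symm.trans hx)
    ext <;> assumption
  · intro x
    obtain ⟨a, b, rfl⟩ := exists_rat_add_rat_mul hs hK x
    exact ⟨⟨a, b⟩, hg _⟩

/-- Trace and norm are rational and integral, hence integers `m` and `N`. Then `p w²` is an integer
for `w` twice the `s`-coordinate, which makes `w` an integer because `p` is squarefree. -/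
theorem exists_half_int_of_isIntegral {p : ℕ} (hp : p.Prime) {s : K}
    (hs : s ^ 2 = ((p : ℤ) : K)) (hK : IntermediateField.adjoin ℚ {s} = ⊤) {x : K}
    (hx : IsIntegral ℤ x) :
    ∃ m w N : ℤ, m ^ 2 - p * w ^ 2 = 4 * N ∧ 2 * x = m + w * s := by
  obtain ⟨f, hf⟩ := exists_ringEquiv_quadraticAlgebra_rat hp hs hK
  obtain ⟨z, rfl⟩ := f.surjective x
  have hz : IsIntegral ℤ z := by
    have := hx.map (f.symm.toRingHom.toIntAlgHom)
    simpa using this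
  have hz' : IsIntegral ℤ (star z) := hz.map (starRingEnd (QuadraticAlgebra ℚ (p : ℚ) 0)).toIntAlgHom
  have hinj := algebraMap_injective (R := ℚ) (a := (p : ℚ)) (b := 0)
  have htr : IsIntegral ℤ (trace z) := by
    rw [← isIntegral_algebraMap_iff hinj, algebraMap_trace_eq_add_star]
    exact hz.add hz'
  have hno : IsIntegral ℤ (norm z) := by
    rw [← isIntegral_algebraMap_iff hinj, algebraMap_norm_eq_mul_star]
    exact hz.mul hz'
  obtain ⟨m, hm⟩ := exists_int_of_isIntegral htr
  obtain ⟨N, hN⟩ := exists_int_of_isIntegral hno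
  rw [trace_def] at hm
  rw [norm_def] at hN
  obtain ⟨w, hw⟩ := exists_int_of_prime_mul_sq hp (w := 2 * z.im) (k := m ^ 2 - 4 * N) (by
    push_cast
    rw [hm, hN]; ring)
  refine ⟨m, w, N, ?_, ?_⟩
  · have : (m : ℚ) ^ 2 - p * w ^ 2 = 4 * N := by rw [hm, hw, hN]; ring
    exact_mod_cast this
  · rw [hf]
    have h1 : ((m : ℚ) : K) = 2 * z.re := by rw [hm]; push_cast; ring
    have h2 : ((w : ℚ) : K) = 2 * z.im := by rw [hw]; push_cast; ring
    push_cast at h1 h2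
    rw [h1, h2]; ring

theorem coe_quadGenInt {d : ℤ} {s : K} (hs : s ^ 2 = (d : K)) :
    ((quadGenInt d s hs : 𝓞 K) : K) = quadGen d s :=
  rfl

theorem exists_ringEquiv_of_sq_eq {p : ℕ} {s : K}
    (hs : s ^ 2 = ((p : ℤ) : K)) {M T : ℤ}
    (hα : quadGen (p : ℤ) s ^ 2 = M + T * quadGen p s)
    (hind : ∀ a b : ℤ, (a : K) + b * quadGen p s = 0 → a = 0 ∧ b = 0)
    (hgen : ∀ x : K, IsIntegral ℤ x → ∃ a b : ℤ, x = a + b * quadGen p s) :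
    ∃ e : QuadraticAlgebra ℤ M T ≃+* 𝓞 K, e ω = quadGenInt p s hs := by
  have hα' : quadGenInt (p : ℤ) s hs * quadGenInt p s hs =
      M • (1 : 𝓞 K) + T • quadGenInt p s hs := by
    apply NumberField.RingOfIntegers.ext
    simp only [map_mul, map_add, coe_quadGenInt, zsmul_eq_mul, map_intCast, mul_one]
    rw [← sq, hα]
  let g : QuadraticAlgebra ℤ M T →ₐ[ℤ] 𝓞 K := lift ⟨quadGenInt p s hs, hα'⟩
  have hg : ∀ x, ((g x : 𝓞 K) : K) = x.re + x.im * quadGen p s := by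
    intro x
    simp [g, lift, coe_quadGenInt]
  refine ⟨RingEquiv.ofBijective g.toRingHom ⟨?_, ?_⟩, ?_⟩
  · rw [injective_iff_map_eq_zero]
    intro x hx
    have hx' : ((g x : 𝓞 K) : K) = 0 := by
      have : g x = 0 := hx
      rw [this]; simp
    rw [hg] at hx'
    obtain ⟨h1, h2⟩ := hind _ _ hx'
    ext <;> assumption
  · intro x
    obtain ⟨a, b, hab⟩ := hgen x x.2
    refine ⟨⟨a, b⟩, ?_⟩
    apply NumberField.RingOfIntegers.ext
    rw [hab]
    exact hg _
  · apply NumberField.RingOfIntegers.ext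
    refine (hg ω).trans ?_
    simp [coe_quadGenInt]

theorem exists_ringEquiv_of_mod_four_eq_one {p : ℕ} (hp : p.Prime) (h4 : p % 4 = 1) {s : K}
    (hs : s ^ 2 = ((p : ℤ) : K)) (hK : IntermediateField.adjoin ℚ {s} = ⊤) {M : ℤ}
    (hM : (p : ℤ) = 4 * M + 1) :
    ∃ e : QuadraticAlgebra ℤ M 1 ≃+* 𝓞 K, e ω = quadGenInt p s hs := by
  have hq : quadGen (p : ℤ) s = (1 + s) / 2 := by rw [quadGen, if_pos (by omega)]
  have hs' : s ^ 2 = 4 * (M : K) + 1 := by rw [hs, hM]; push_cast; ring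
  refine exists_ringEquiv_of_sq_eq hs ?_ ?_ ?_
  · rw [hq]
    field_simp
    push_cast
    linear_combination hs'
  · intro a b h
    rw [hq] at h
    have h1 : (((a + b / 2 : ℚ)) : K) + ((b / 2 : ℚ) : K) * s = 0 := by
      push_cast
      rw [← h]; ring
    obtain ⟨h2, h3⟩ := eq_zero_of_rat_add_rat_mul hp hs h1
    have h4 : (b : ℚ) = 0 := by linarith
    have h5 : (a : ℚ) = 0 := by linarith
    exact ⟨by exact_mod_cast h5, by exact_mod_cast h4⟩
  · intro x hx
    obtain ⟨m, w, N, h1, h2⟩ := exists_half_int_of_isIntegral hp hs hK hx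
    have h3 : (2 : ℤ) ∣ m - w := by
      have h6 : Even (m ^ 2 - w ^ 2) := ⟨2 * N + 2 * M * w ^ 2, by
        rw [hM] at h1; linear_combination h1⟩
      rw [Int.even_sub, Int.even_pow' two_ne_zero, Int.even_pow' two_ne_zero, ← Int.even_sub] at h6
      exact h6.two_dvd
    obtain ⟨c, hc⟩ := h3
    refine ⟨c, w, ?_⟩
    rw [hq]
    have : (m : K) = 2 * c + w := by
      rw [show m = 2 * c + w by linarith]; push_cast; ring
    have h20 : (2 : K) ≠ 0 := two_ne_zero
    field_simp
    rw [mul_comm, h2, this]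
    ring

theorem exists_ringEquiv_of_mod_four_ne_one {p : ℕ} (hp : p.Prime) (h4 : p % 4 ≠ 1) {s : K}
    (hs : s ^ 2 = ((p : ℤ) : K)) (hK : IntermediateField.adjoin ℚ {s} = ⊤) :
    ∃ e : QuadraticAlgebra ℤ (p : ℤ) 0 ≃+* 𝓞 K, e ω = quadGenInt p s hs := by
  have hq : quadGen (p : ℤ) s = s := by rw [quadGen, if_neg (by omega)]
  refine exists_ringEquiv_of_sq_eq hs ?_ ?_ ?_
  · rw [hq, hs]; simp
  · intro a b h
    rw [hq] at h
    obtain ⟨h2, h3⟩ := eq_zero_of_rat_add_rat_mul hp hs (a := a) (b := b) (by push_cast; exact h)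
    exact ⟨by exact_mod_cast h2, by exact_mod_cast h3⟩
  · intro x hx
    obtain ⟨m, w, N, h1, h2⟩ := exists_half_int_of_isIntegral hp hs hK hx
    have h3 : Even m ∧ Even w := by
      have hp4 : p = 2 ∨ p % 4 = 3 := by
        rcases hp.eq_two_or_odd with h | h
        · exact Or.inl h
        · omega
      rcases hp4 with rfl | hp4
      · obtain ⟨k, rfl⟩ : Even m := by
          have : Even (m ^ 2) := ⟨w ^ 2 + 2 * N, by push_cast at h1; linear_combination h1⟩
          exact (Int.even_pow' two_ne_zero).mp this
        refine ⟨⟨k, rfl⟩, ?_⟩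
        have : Even (w ^ 2) := ⟨k ^ 2 - N, by push_cast at h1; linarith⟩
        exact (Int.even_pow' two_ne_zero).mp this
      · have h5 : ((p : ℤ)) = 4 * (p / 4 : ℕ) + 3 := by omega
        rw [h5] at h1
        rcases Int.even_or_odd m with hm | hm <;> rcases Int.even_or_odd w with hw | hw
        · exact ⟨hm, hw⟩
        all_goals
          exfalso
          obtain ⟨a, rfl⟩ := hm
          obtain ⟨b, rfl⟩ := hw
          ring_nf at h1
          omega
    obtain ⟨⟨a, rfl⟩, b, rfl⟩ := h3
    refine ⟨a, b, ?_⟩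
    have h20 : (2 : K) ≠ 0 := two_ne_zero
    apply mul_left_cancel₀ h20
    rw [hq, h2]
    push_cast
    ring

end quadraticField

/-! ### Pell equations for a prime. -/

/-- Descent on the fundamental solution `(x, y)`. If `y` is even, then `x = 2X + 1` and `X (X + 1) =
p Y²` splits into coprime factors, one a square and the other `p` times a square. -/
theorem exists_pell_odd_or_negative_pell {p : ℕ} (hp : p.Prime) :
    (∃ a b : ℤ, a ^ 2 - p * b ^ 2 = 1 ∧ Odd b) ∨ ∃ a b : ℤ, a ^ 2 - p * b ^ 2 = -1 := by
  have hp0 : (0 : ℤ) < p := by exact_mod_cast hp.pos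
  have hpp : Prime (p : ℤ) := Nat.prime_iff_prime_int.mp hp
  obtain ⟨f, hf⟩ := Pell.IsFundamental.exists_of_not_isSquare hp0 hpp.not_isSquare
  have h1 := f.prop
  rcases Int.even_or_odd f.y with hy | hy
  swap
  · exact Or.inl ⟨f.x, f.y, h1, hy⟩
  right
  obtain ⟨Y, hY⟩ := hy
  have hx : Odd f.x := by
    rw [← Int.not_even_iff_odd]
    rintro ⟨k, hk⟩
    rw [hk, hY] at h1
    ring_nf at h1
    omega
  obtain ⟨X, hX⟩ := hx
  have hX0 : 0 < X := by have := hf.1; omega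
  have h2 : X * (X + 1) = p * Y ^ 2 := by
    rw [hX, hY] at h1
    linarith
  have hsq : ∀ {a b : ℤ}, IsCoprime a b → 0 ≤ a → a * b = Y ^ 2 → ∃ r, a = r ^ 2 := by
    intro a b hab ha h
    obtain ⟨r, hr | hr⟩ := Int.sq_of_isCoprime hab h
    · exact ⟨r, hr⟩
    · exact ⟨0, by nlinarith [sq_nonneg r]⟩
  rcases hpp.dvd_or_dvd (Dvd.intro _ h2.symm) with ⟨Z, hZ⟩ | ⟨Z, hZ⟩
  -- If `p ∣ X`, then `X + 1 = r²` and `X = p t²` give a solution with `r` smaller than the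
  -- fundamental `2X + 1`.
  · exfalso
    have hZ0 : 0 ≤ Z := by nlinarith
    have h3 : Z * (X + 1) = Y ^ 2 := by
      apply mul_left_cancel₀ hp0.ne'
      rw [← h2, hZ]; ring
    have hc : IsCoprime Z (X + 1) := ⟨-p, 1, by rw [hZ]; ring⟩
    obtain ⟨t, ht⟩ := hsq hc hZ0 h3
    obtain ⟨r, hr⟩ := hsq hc.symm (by linarith) (by rw [mul_comm]; exact h3)
    have h4 : |r| ^ 2 - p * t ^ 2 = 1 := by
      rw [sq_abs, ← hr, ← ht, ← hZ]; ring
    have h5 : |r| ^ 2 = X + 1 := by rw [sq_abs, hr]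
    have h6 := hf.x_le_x (a := Pell.Solution₁.mk |r| t h4) (by
      rw [Pell.Solution₁.x_mk]
      nlinarith [abs_nonneg r])
    rw [Pell.Solution₁.x_mk] at h6
    nlinarith [abs_nonneg r]
  -- If `p ∣ X + 1`, then `X = r²` and `X + 1 = p t²`, a solution with right side `-1`.
  · have hZ0 : 0 ≤ Z := by nlinarith
    have h3 : Z * X = Y ^ 2 := by
      apply mul_left_cancel₀ hp0.ne'
      rw [← h2, hZ]; ring
    have hc : IsCoprime Z X := ⟨p, -1, by linear_combination -hZ⟩
    obtain ⟨t, ht⟩ := hsq hc hZ0 h3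
    obtain ⟨r, hr⟩ := hsq hc.symm hX0.le (by rw [mul_comm]; exact h3)
    exact ⟨r, t, by rw [← ht, ← hr]; linarith⟩

theorem exists_negative_pell {p : ℕ} (hp : p.Prime) (h4 : p % 4 ≠ 3) :
    ∃ a b : ℤ, a ^ 2 - p * b ^ 2 = -1 := by
  rcases hp.eq_two_or_odd' with rfl | hp2
  · exact ⟨1, 1, by norm_num⟩
  rcases exists_pell_odd_or_negative_pell hp with ⟨a, b, h, k, rfl⟩ | h
  · exfalso
    obtain ⟨c, hc⟩ : ∃ c : ℤ, (p : ℤ) = 4 * c + 1 := ⟨p / 4, by have := hp2; grind⟩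
    rw [hc] at h
    rcases Int.even_or_odd a with ⟨l, rfl⟩ | ⟨l, rfl⟩ <;> ring_nf at h <;> omega
  · exact h

theorem exists_pell_odd {p : ℕ} (hp : p.Prime) (h4 : p % 4 = 3) :
    ∃ a b : ℤ, a ^ 2 - p * b ^ 2 = 1 ∧ Odd b := by
  rcases exists_pell_odd_or_negative_pell hp with h | ⟨a, b, h⟩
  · exact h
  · exfalso
    obtain ⟨c, hc⟩ : ∃ c : ℤ, (p : ℤ) = 4 * c + 3 := ⟨p / 4, by omega⟩
    rw [hc] at h
    rcases Int.even_or_odd a with ⟨l, rfl⟩ | ⟨l, rfl⟩ <;>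
    rcases Int.even_or_odd b with ⟨k, rfl⟩ | ⟨k, rfl⟩ <;> ring_nf at h <;> omega

theorem negative_pell_parity {p : ℕ} (h4 : p % 4 = 1) {a b : ℤ} (h : a ^ 2 - p * b ^ 2 = -1) :
    Even a ∧ Odd b := by
  obtain ⟨c, hc⟩ : ∃ c : ℤ, (p : ℤ) = 4 * c + 1 := ⟨p / 4, by omega⟩
  rw [hc] at h
  have h5 : (a % 2 = 0 ∨ a % 2 = 1) ∧ (b % 2 = 0 ∨ b % 2 = 1) := by omega
  rw [Int.even_iff, Int.odd_iff]
  rcases h5 with ⟨ha | ha, hb | hb⟩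
  · exfalso
    rw [show a = 2 * (a / 2) by omega, show b = 2 * (b / 2) by omega] at h
    ring_nf at h
    omega
  · exact ⟨ha, hb⟩
  · exfalso
    rw [show a = 2 * (a / 2) + 1 by omega, show b = 2 * (b / 2) by omega] at h
    ring_nf at h
    omega
  · exfalso
    rw [show a = 2 * (a / 2) + 1 by omega, show b = 2 * (b / 2) + 1 by omega] at h
    ring_nf at h
    omega

/-! ### Units and the passage between powers of a prime. -/

namespace QuadraticAlgebra

variable {M T : ℤ}

theorem eq_re_add_im_mul_omega (z : QuadraticAlgebra ℤ M T) :
    z = (z.re : QuadraticAlgebra ℤ M T) + (z.im : QuadraticAlgebra ℤ M T) * ω := by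
  ext <;> simp

theorem exists_unit {a b : ℤ} (h : IsUnit (a ^ 2 + T * a * b - M * b ^ 2)) :
    ∃ u : (QuadraticAlgebra ℤ M T)ˣ, (u : QuadraticAlgebra ℤ M T) = ⟨a, b⟩ := by
  have h1 : IsUnit (⟨a, b⟩ : QuadraticAlgebra ℤ M T) := by
    rw [isUnit_iff_norm_isUnit, norm_def]
    change IsUnit (a * a + T * a * b - M * b * b)
    rwa [show a * a + T * a * b - M * b * b = a ^ 2 + T * a * b - M * b ^ 2 by ring]
  exact ⟨h1.unit, rfl⟩

theorem norm_unit (u : (QuadraticAlgebra ℤ M T)ˣ) :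
    norm (u : QuadraticAlgebra ℤ M T) = 1 ∨ norm (u : QuadraticAlgebra ℤ M T) = -1 :=
  Int.isUnit_iff.mp (isUnit_iff_norm_isUnit.mp u.isUnit)

theorem not_dvd_re_unit {q : ℤ} (hq : Prime q) {u : (QuadraticAlgebra ℤ M T)ˣ}
    (hu : q ∣ (u : QuadraticAlgebra ℤ M T).im) : ¬ q ∣ (u : QuadraticAlgebra ℤ M T).re := by
  intro h
  have h1 : q ∣ norm (u : QuadraticAlgebra ℤ M T) := by
    rw [norm_def]
    exact dvd_sub (dvd_add (h.mul_left _) (hu.mul_left _)) (hu.mul_left _)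
  exact hq.not_isUnit (isUnit_of_dvd_unit h1 (isUnit_iff_norm_isUnit.mp u.isUnit))

/-- Powers of `A + z` modulo an element `n` dividing `z ^ 2`. -/
theorem _root_.dvd_mul_add_pow_sub {S : Type*} [CommRing S] {n A z : S} (h : n ∣ z ^ 2) (t : ℕ) :
    n ∣ A * (A + z) ^ t - A ^ t * (A + t * z) := by
  induction t with
  | zero => simp
  | succ t ih =>
    obtain ⟨a, ha⟩ := h
    obtain ⟨b, hb⟩ := ih
    refine ⟨(A + z) * b + A ^ t * t * a, ?_⟩
    push_cast
    linear_combination (A + z) * hb + A ^ t * t * ha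

end QuadraticAlgebra

open QuadraticAlgebra

theorem UnitsCover.of_prime_pow {M T : ℤ} {q j k : ℕ} (hj : 1 ≤ j) (hjk : j ≤ k)
    (h : UnitsCover M T ((q ^ k : ℕ) : ℤ)) : UnitsCover M T ((q ^ j : ℕ) : ℤ) := by
  intro x hx
  push_cast at h hx ⊢
  rw [IsCoprime.pow_right_iff (by omega)] at hx
  obtain ⟨u, c, hu⟩ := h x ((IsCoprime.pow_right_iff (by omega)).mpr hx)
  refine ⟨u, c, dvd_trans ?_ hu⟩
  push_cast
  exact pow_dvd_pow _ hjk

/-- If `x ≡ c u` modulo `q^(k+1)` with `c` prime to `q`, then `u` inherits the exact divisibility of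
the `ω`-coefficient of `x`. -/
theorem UnitsCover.exists_unit_im {M T : ℤ} {q k : ℕ} (h : UnitsCover M T ((q ^ (k + 1) : ℕ) : ℤ))
    {x : QuadraticAlgebra ℤ M T} (hx : IsCoprime x.norm q) (hk : (q : ℤ) ^ k ∣ x.im)
    (hk' : ¬ (q : ℤ) ^ (k + 1) ∣ x.im) : ∃ u : (QuadraticAlgebra ℤ M T)ˣ,
      (q : ℤ) ^ k ∣ (u : QuadraticAlgebra ℤ M T).im ∧
      ¬ (q : ℤ) ^ (k + 1) ∣ (u : QuadraticAlgebra ℤ M T).im := by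
  push_cast at h
  obtain ⟨u, c, hu⟩ := h x hx.pow_right
  have hcop : IsCoprime c q := by
    obtain ⟨m, hm⟩ := intCast_dvd_norm_sub hu
    rw [map_mul, norm_intCast, Int.cast_id] at hm
    rw [show x.norm = c * (c * norm (u : QuadraticAlgebra ℤ M T)) + q * (q ^ k * m) by
      linear_combination hm] at hx
    exact hx.of_add_mul_left_left.of_mul_left_left
  obtain ⟨-, h2⟩ := intCast_dvd_iff.mp hu
  simp only [im_sub, im_mul, re_intCast, im_intCast, zero_mul, mul_zero, add_zero] at h2
  refine ⟨u, ?_, fun h3 => hk' ?_⟩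
  · have h3 : (q : ℤ) ^ k ∣ c * (u : QuadraticAlgebra ℤ M T).im :=
      (dvd_sub_right hk).mp ((pow_dvd_pow _ (Nat.le_succ k)).trans (by simpa using h2))
    exact hcop.symm.pow_left.dvd_of_dvd_mul_left h3
  · exact (dvd_sub_left (h3.mul_left c)).mp (by simpa using h2)

theorem UnitsCover.succ {M T : ℤ} {q k : ℕ} (hq : q.Prime) (hk : 1 ≤ k)
    (h : UnitsCover M T ((q ^ k : ℕ) : ℤ)) {η : (QuadraticAlgebra ℤ M T)ˣ}
    (hη : (q : ℤ) ^ k ∣ (η : QuadraticAlgebra ℤ M T).im)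
    (hη' : ¬ (q : ℤ) ^ (k + 1) ∣ (η : QuadraticAlgebra ℤ M T).im) :
    UnitsCover M T ((q ^ (k + 1) : ℕ) : ℤ) := by
  have hqp : Prime (q : ℤ) := Nat.prime_iff_prime_int.mp hq
  have hA := not_dvd_re_unit hqp ((dvd_pow_self _ (by omega)).trans hη)
  obtain ⟨B, hB⟩ := hη
  have hBq : ¬ (q : ℤ) ∣ B := fun ⟨l, hl⟩ => hη' ⟨l, by rw [hB, hl]; ring⟩
  have hη2 := eq_re_add_im_mul_omega (η : QuadraticAlgebra ℤ M T)
  intro x hx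
  rw [Nat.cast_pow] at hx h ⊢
  rw [IsCoprime.pow_right_iff (by omega)] at hx
  obtain ⟨u, c, y, hy⟩ := h x hx.pow_right
  rw [pow_succ']
  have hqQ : (q : ℤ) ∣ (q : ℤ) ^ k := dvd_pow_self _ (by omega)
  rw [hB] at hη2
  obtain ⟨A, hAdef⟩ : ∃ A, A = (η : QuadraticAlgebra ℤ M T).re := ⟨_, rfl⟩
  rw [← hAdef] at hA hη2
  have hAq : IsCoprime A (q : ℤ) := by
    rw [isCoprime_comm]; exact hqp.coprime_iff_not_dvd.mpr hA
  obtain ⟨A', e, hA'⟩ := hAq.mul_right (hAq.pow_right (n := k))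
  obtain ⟨Q, hQ⟩ : ∃ Q, Q = (q : ℤ) ^ k := ⟨_, rfl⟩
  rw [← hQ] at hqQ hη2 hy hA' ⊢
  set z : QuadraticAlgebra ℤ M T := x * (u⁻¹ : (QuadraticAlgebra ℤ M T)ˣ) with hz
  have hzx : x = z * u := by rw [hz, mul_assoc, Units.inv_mul, mul_one]
  obtain ⟨w, hw⟩ : ∃ w : QuadraticAlgebra ℤ M T, z = c + Q * w := by
    refine ⟨y * (u⁻¹ : (QuadraticAlgebra ℤ M T)ˣ), ?_⟩
    have h1 := Units.mul_inv u
    rw [hz]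
    linear_combination (u⁻¹ : (QuadraticAlgebra ℤ M T)ˣ) * hy + c * h1
  have hzim : z.im = Q * w.im := by rw [hw]; simp
  have hz2 := eq_re_add_im_mul_omega z
  have hzq : IsCoprime z.re (q : ℤ) := by
    rw [isCoprime_comm, hqp.coprime_iff_not_dvd]
    intro hd
    have h1 : (q : ℤ) ∣ z.norm := by
      have h2 : (q : ℤ) ∣ z.im := hzim ▸ hqQ.mul_right _
      rw [norm_def]
      exact dvd_sub (dvd_add (hd.mul_left _) (h2.mul_left _)) (h2.mul_left _)
    rw [hzx, map_mul] at hx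
    exact hqp.not_isUnit (hx.of_mul_left_left.isUnit_of_dvd' h1 dvd_rfl)
  rw [hzim] at hz2
  have hBq' : IsCoprime B (q : ℤ) := by
    rw [isCoprime_comm]; exact hqp.coprime_iff_not_dvd.mpr hBq
  obtain ⟨m, e', hm⟩ := hzq.mul_left hBq'
  -- With `η = A + QBω`, one has `(η/A)^t ≡ 1 + t Q (B/A) ω` modulo `qQ`. Matching this with `z/z.re
  -- ≡ 1 + Q (w.im/z.re) ω` gives `t ≡ A * w.im / (z.re * B)` modulo `q`.
  obtain ⟨t, l, ht⟩ : ∃ (t : ℕ) (l : ℤ), (t : ℤ) = A * w.im * m + q * l := by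
    have h0 : (q : ℤ) ≠ 0 := hqp.ne_zero
    refine ⟨((A * w.im * m) % q).toNat, -((A * w.im * m) / q), ?_⟩
    rw [Int.toNat_of_nonneg (Int.emod_nonneg _ h0), Int.emod_def]
    ring
  obtain ⟨f, hf⟩ : (q * Q) ∣ (A' * A) ^ t - 1 ^ t :=
    dvd_trans ⟨-e, by linear_combination hA'⟩ (sub_dvd_pow_sub_pow _ _ t)
  obtain ⟨g, hg⟩ := dvd_mul_add_pow_sub (n := ((q * Q : ℤ) : QuadraticAlgebra ℤ M T))
    (A := (A : QuadraticAlgebra ℤ M T))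
    -- Here `k ≥ 1` is essential: `q ∣ Q` makes `Q²` vanish modulo `qQ`.
    (z := ((Q * B : ℤ) : QuadraticAlgebra ℤ M T) * ω) (by
      obtain ⟨j, hj⟩ := hqQ
      have hj' := congrArg (Int.cast : ℤ → QuadraticAlgebra ℤ M T) hj
      refine ⟨j * (B * (ω : QuadraticAlgebra ℤ M T)) ^ 2, ?_⟩
      push_cast at hj' ⊢
      linear_combination (Q * B ^ 2 * ω ^ 2) * hj') t
  rw [← hη2] at hg
  refine ⟨u * η ^ t, z.re * A' ^ t, ?_⟩
  have key : ((q * Q : ℤ) : QuadraticAlgebra ℤ M T) ∣ z - (z.re * A' ^ t : ℤ) * η ^ t := by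
    have e1 := congrArg (Int.cast : ℤ → QuadraticAlgebra ℤ M T) hA'
    have e2 := congrArg (Int.cast : ℤ → QuadraticAlgebra ℤ M T) hm
    have e3 := congrArg (Int.cast : ℤ → QuadraticAlgebra ℤ M T) ht
    have e4 := congrArg (Int.cast : ℤ → QuadraticAlgebra ℤ M T) hf
    push_cast [mul_pow] at e1 e2 e3 e4 hg hz2 ⊢
    generalize (z.re : QuadraticAlgebra ℤ M T) = zr at *
    generalize (w.im : QuadraticAlgebra ℤ M T) = wi at *
    generalize (ω : QuadraticAlgebra ℤ M T) = v at *
    refine ⟨-(e * (zr * A' ^ t * η ^ t) + A' * zr * f * (A + t * (Q * B * v))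
      + A' * zr * A' ^ t * g - zr * e - v * wi * e' - e * (Q * v * wi * zr * B * m)
      + A' * zr * B * v * l), ?_⟩
    linear_combination hz2 + (zr * A' ^ t * η ^ t - zr - zr * Q * B * v * wi * m) * e1
      - A' * zr * A' ^ t * hg - A' * zr * (A + t * (Q * B * v)) * e4
      - A' * zr * Q * B * v * e3 - Q * v * wi * e2
  rw [hzx]
  have h5 : z * u - ((z.re * A' ^ t : ℤ) : QuadraticAlgebra ℤ M T) *
      ((u * η ^ t : (QuadraticAlgebra ℤ M T)ˣ) : QuadraticAlgebra ℤ M T)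
      = (z - ((z.re * A' ^ t : ℤ) : QuadraticAlgebra ℤ M T) * η ^ t) * u := by
    push_cast
    ring
  rw [h5]
  exact key.mul_right _

/-- The binomial expansion with its first two terms in each coordinate; the factor `A ^ 3` avoids
exponents such as `m - 3`. -/
theorem exists_add_mul_pow_eq {S : Type*} [CommRing S] (A B D : ℤ) {δ : S} (hδ : δ ^ 2 = D)
    (m : ℕ) : ∃ X Y e f : ℤ, (A + B * δ) ^ m = X + Y * δ ∧
      A ^ 3 * X = A ^ m * (A ^ 3 + m.choose 2 * A * B ^ 2 * D) + B ^ 4 * D ^ 2 * e ∧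
      A ^ 3 * Y = A ^ m * (m * A ^ 2 * B + m.choose 3 * B ^ 3 * D) + B ^ 5 * D ^ 2 * f := by
  induction m with
  | zero => exact ⟨1, 0, 0, 0, by simp, by simp, by simp⟩
  | succ m ih =>
    obtain ⟨X, Y, e, f, h1, h2, h3⟩ := ih
    refine ⟨A * X + B * D * Y, A * Y + B * X, A * e + A ^ m * m.choose 3 + B ^ 2 * D * f,
      A * f + e, ?_, ?_, ?_⟩
    · rw [pow_succ, h1]
      push_cast
      linear_combination (B * Y : S) * hδ
    · rw [show (m + 1).choose 2 = m + m.choose 2 by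
        rw [Nat.choose_succ_succ' m 1, Nat.choose_one_right]]
      push_cast
      linear_combination A * h2 + B * D * h3
    · rw [Nat.choose_succ_succ' m 2]
      push_cast
      linear_combination A * h3 + B * h2

/-- The unit is `u^q`. Write `2u = a + bδ` with `δ² = D` the discriminant. The leading term `q
a^(q-1) b` of the `δ`-coefficient of the `q`-th power gains exactly one factor `q`. The remaining
terms gain more, thanks to `k ≥ 1` or `q ∣ D`, except when `q = 3` and `k = 0`. -/
theorem exists_unit_im_succ_of_odd {M T : ℤ} {q k : ℕ} (hq : q.Prime) (hq2 : Odd q)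
    (hk : 1 ≤ k ∨ (q : ℤ) ∣ T ^ 2 + 4 * M ∧ (q = 3 → (T ^ 2 + 4 * M) % 9 = 3))
    (h : ∃ u : (QuadraticAlgebra ℤ M T)ˣ, (q : ℤ) ^ k ∣ (u : QuadraticAlgebra ℤ M T).im ∧
      ¬ (q : ℤ) ^ (k + 1) ∣ (u : QuadraticAlgebra ℤ M T).im) :
    ∃ u : (QuadraticAlgebra ℤ M T)ˣ, (q : ℤ) ^ (k + 1) ∣ (u : QuadraticAlgebra ℤ M T).im ∧
      ¬ (q : ℤ) ^ (k + 1 + 1) ∣ (u : QuadraticAlgebra ℤ M T).im := by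
  obtain ⟨u, ⟨b, hb⟩, hu'⟩ := h
  have hqp : Prime (q : ℤ) := Nat.prime_iff_prime_int.mp hq
  have hbq : ¬ (q : ℤ) ∣ b := fun ⟨l, hl⟩ => hu' ⟨l, by rw [hb, hl]; ring⟩
  have hq2' : IsCoprime (q : ℤ) 2 := by
    exact_mod_cast Nat.isCoprime_iff_coprime.mpr hq2.coprime_two_right
  obtain ⟨a, ha⟩ : ∃ a, a = 2 * (u : QuadraticAlgebra ℤ M T).re +
    T * (u : QuadraticAlgebra ℤ M T).im := ⟨_, rfl⟩
  obtain ⟨D, hD⟩ : ∃ D, D = T ^ 2 + 4 * M := ⟨_, rfl⟩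
  rw [← hD] at hk
  have hqB : (q : ℤ) ∣ D * (q ^ k * b) ^ 2 := by
    rcases hk with hk | ⟨hk, -⟩
    · exact (((dvd_pow_self _ (by omega)).mul_right _).pow two_ne_zero).mul_left _
    · exact hk.mul_right _
  have haq : ¬ (q : ℤ) ∣ a := by
    intro hd
    have h1 : a ^ 2 - D * (q ^ k * b) ^ 2 = 4 * norm (u : QuadraticAlgebra ℤ M T) := by
      rw [norm_def, ← hb, ha, hD]; ring
    have h2 : (q : ℤ) ∣ 4 * norm (u : QuadraticAlgebra ℤ M T) := by
      rw [← h1]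
      exact dvd_sub (hd.pow two_ne_zero) hqB
    have h3 : IsUnit (norm (u : QuadraticAlgebra ℤ M T)) := isUnit_iff_norm_isUnit.mp u.isUnit
    rw [h3.dvd_mul_right] at h2
    have h4 : IsCoprime (q : ℤ) 4 := by
      rw [show (4 : ℤ) = 2 * 2 by norm_num]; exact hq2'.mul_right hq2'
    exact hqp.not_isUnit (h4.isUnit_of_dvd' dvd_rfl h2)
  have hδ : (2 * (ω : QuadraticAlgebra ℤ M T) - (T : QuadraticAlgebra ℤ M T)) ^ 2 =
      (D : QuadraticAlgebra ℤ M T) := by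
    rw [hD]
    ext <;> simp [sq] <;> ring
  obtain ⟨X, Y, e, f, h1, -, h3⟩ := exists_add_mul_pow_eq a (q ^ k * b) D hδ q
  have hY : 2 ^ q * ((u ^ q : (QuadraticAlgebra ℤ M T)ˣ) : QuadraticAlgebra ℤ M T).im = 2 * Y := by
    have h4 : (a : QuadraticAlgebra ℤ M T) + ((q ^ k * b : ℤ) : QuadraticAlgebra ℤ M T) *
        (2 * (ω : QuadraticAlgebra ℤ M T) - (T : QuadraticAlgebra ℤ M T)) = 2 * u := by
      rw [← hb]
      ext
      · simp [ha]; ring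
      · simp; ring
    rw [h4, mul_pow] at h1
    have h5 := congrArg QuadraticAlgebra.im h1
    have h6 : (2 : QuadraticAlgebra ℤ M T) ^ q = ((2 ^ q : ℤ) : QuadraticAlgebra ℤ M T) := by
      push_cast; rfl
    rw [h6, im_mul, re_intCast, im_intCast, Int.cast_id] at h5
    simp only [im_add, im_sub, im_mul, re_intCast, im_intCast, re_sub, re_ofNat, im_ofNat, omega_im,
      omega_re, re_mul, Int.cast_id] at h5
    rw [Units.val_pow_eq_pow_val]
    linarith
  obtain ⟨E, hE, hqE⟩ : ∃ E : ℤ, a ^ 3 * Y = q ^ (k + 1) * E ∧ ¬ (q : ℤ) ∣ E := by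
    have hmain : ¬ (q : ℤ) ∣ a ^ (q + 2) * b := fun hd =>
      (hqp.dvd_or_dvd hd).elim (fun h => haq (hqp.dvd_of_dvd_pow h)) hbq
    by_cases hk1 : 1 ≤ k
    · obtain ⟨j, rfl⟩ : ∃ j, k = j + 1 := ⟨k - 1, by omega⟩
      refine ⟨a ^ (q + 2) * b + q * (a ^ q * (q.choose 3 * (q ^ j) ^ 2 * b ^ 3 * D)
        + q ^ (4 * j + 2) * b ^ 5 * D ^ 2 * f), ?_, ?_⟩
      · rw [h3]; ring
      · rwa [dvd_add_left (dvd_mul_right _ _)]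
    · obtain ⟨⟨d, hd⟩, hk3⟩ := hk.resolve_left hk1
      obtain rfl : k = 0 := by omega
      by_cases hq3 : q = 3
      · subst hq3
        -- Since `3.choose 3 = 1`, the cubic term has the same order as the leading one. With `d ≡
        -- 1` modulo 3 their sum involves `a² + b² ≡ 2`, so nothing cancels.
        refine ⟨a ^ 3 * b * (a ^ 2 + b ^ 2 * d) + 3 * (b ^ 5 * d ^ 2 * f), ?_, ?_⟩
        · rw [h3, hd]; push_cast; simp; ring
        · have h4 := hk3 rfl
          push_cast at haq hbq hqp hd ⊢
          rw [dvd_add_left (dvd_mul_right _ _)]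
          intro h5
          rcases hqp.dvd_or_dvd h5 with h5 | h5
          · exact (hqp.dvd_or_dvd h5).elim (fun h => haq (hqp.dvd_of_dvd_pow h)) hbq
          · have h6 : d % 3 = 1 := by omega
            rw [Int.dvd_iff_emod_eq_zero] at haq hbq h5
            have ha3 : a % 3 = 1 ∨ a % 3 = 2 := by omega
            have hb3 : b % 3 = 1 ∨ b % 3 = 2 := by omega
            rcases ha3 with ha3 | ha3 <;> rcases hb3 with hb3 | hb3 <;>
              simp [Int.add_emod, Int.mul_emod, pow_two, h6, ha3, hb3] at h5
      · obtain ⟨c, hc⟩ : q ∣ q.choose 3 := hq.dvd_choose_self (by norm_num) (by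
          have := hq.two_le
          obtain ⟨l, hl⟩ := hq2
          omega)
        refine ⟨a ^ (q + 2) * b + q * (a ^ q * (c * b ^ 3 * d) + b ^ 5 * d ^ 2 * f), ?_, ?_⟩
        · rw [h3, hd, hc]; push_cast; ring
        · rwa [dvd_add_left (dvd_mul_right _ _)]
  have hac : IsCoprime (q : ℤ) a := hqp.coprime_iff_not_dvd.mpr haq
  refine ⟨u ^ q, ?_, fun hd => hqE ?_⟩
  · have h4 : (q : ℤ) ^ (k + 1) ∣ Y :=
      (hac.pow (m := k + 1) (n := 3)).dvd_of_dvd_mul_left (Dvd.intro _ hE.symm)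
    refine (hq2'.pow (m := k + 1) (n := q)).dvd_of_dvd_mul_left ?_
    rw [hY]
    exact h4.mul_left _
  · have h4 : (q : ℤ) ^ (k + 1 + 1) ∣ Y := by
      refine (hq2'.pow_left (m := k + 1 + 1)).dvd_of_dvd_mul_left ?_
      rw [← hY]
      exact hd.mul_left _
    have h5 : (q : ℤ) ^ (k + 1) * q ∣ q ^ (k + 1) * E := by
      rw [← hE, ← pow_succ]
      exact h4.mul_left _
    exact (mul_dvd_mul_iff_left (pow_ne_zero _ hqp.ne_zero)).mp h5

theorem exists_unit_im_succ_two {k : ℕ}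
    (h : ∃ u : (QuadraticAlgebra ℤ (2 : ℤ) 0)ˣ,
      (2 : ℤ) ^ k ∣ (u : QuadraticAlgebra ℤ (2 : ℤ) 0).im ∧
      ¬ (2 : ℤ) ^ (k + 1) ∣ (u : QuadraticAlgebra ℤ (2 : ℤ) 0).im) :
    ∃ u : (QuadraticAlgebra ℤ (2 : ℤ) 0)ˣ,
      (2 : ℤ) ^ (k + 1) ∣ (u : QuadraticAlgebra ℤ (2 : ℤ) 0).im ∧
      ¬ (2 : ℤ) ^ (k + 1 + 1) ∣ (u : QuadraticAlgebra ℤ (2 : ℤ) 0).im := by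
  obtain ⟨u, ⟨b, hb⟩, hu'⟩ := h
  have hbq : ¬ (2 : ℤ) ∣ b := fun ⟨l, hl⟩ => hu' ⟨l, by rw [hb, hl]; ring⟩
  have ha : ¬ (2 : ℤ) ∣ (u : QuadraticAlgebra ℤ (2 : ℤ) 0).re := by
    rintro ⟨l, hl⟩
    have h1 := norm_unit u
    rw [norm_def, hl] at h1
    ring_nf at h1
    omega
  have him : ((u ^ 2 : (QuadraticAlgebra ℤ (2 : ℤ) 0)ˣ) : QuadraticAlgebra ℤ (2 : ℤ) 0).im =
      2 ^ (k + 1) * ((u : QuadraticAlgebra ℤ (2 : ℤ) 0).re * b) := by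
    rw [Units.val_pow_eq_pow_val, sq, im_mul, hb]
    ring
  refine ⟨u ^ 2, him ▸ dvd_mul_right _ _, ?_⟩
  rw [him, pow_succ _ (k + 1), mul_dvd_mul_iff_left (by positivity)]
  exact fun h => (Int.prime_two.dvd_or_dvd h).elim ha hbq

theorem UnitsCover.all_of_units {M T : ℤ} {q n : ℕ} (hq : q.Prime) (hn : 1 ≤ n)
    (h : UnitsCover M T ((q ^ n : ℕ) : ℤ))
    (hu : ∀ k, n ≤ k → ∃ u : (QuadraticAlgebra ℤ M T)ˣ,
      (q : ℤ) ^ k ∣ (u : QuadraticAlgebra ℤ M T).im ∧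
      ¬ (q : ℤ) ^ (k + 1) ∣ (u : QuadraticAlgebra ℤ M T).im) {k : ℕ} (hk : 1 ≤ k) :
    UnitsCover M T ((q ^ k : ℕ) : ℤ) := by
  rcases le_total k n with hkn | hkn
  · exact h.of_prime_pow hk hkn
  · induction k, hkn using Nat.le_induction with
    | base => exact h
    | succ k hk' ih =>
      obtain ⟨u, h1, h2⟩ := hu k hk'
      exact (ih (by omega)).succ hq (by omega) h1 h2

theorem UnitsCover.all_of_sq {M T : ℤ} {q : ℕ} (hq : q.Prime) (hq2 : Odd q)
    (h : UnitsCover M T ((q ^ 2 : ℕ) : ℤ)) {k : ℕ} (hk : 1 ≤ k) :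
    UnitsCover M T ((q ^ k : ℕ) : ℤ) := by
  have hqp : Prime (q : ℤ) := Nat.prime_iff_prime_int.mp hq
  have h1 : ∀ k, 1 ≤ k → ∃ u : (QuadraticAlgebra ℤ M T)ˣ,
      (q : ℤ) ^ k ∣ (u : QuadraticAlgebra ℤ M T).im ∧
      ¬ (q : ℤ) ^ (k + 1) ∣ (u : QuadraticAlgebra ℤ M T).im := by
    intro k hk
    induction k, hk using Nat.le_induction with
    | base =>
      -- The element `1 + qω` is `1` modulo `q`, so its norm is prime to `q`.
      refine UnitsCover.exists_unit_im (k := 1) h (x := ⟨1, q⟩) ?_ ?_ ?_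
      · refine ⟨1, -(T - M * q), ?_⟩
        rw [norm_def]; ring
      · simp
      · intro hd
        have : (q : ℤ) ^ 1 * q ∣ q ^ 1 * 1 := by simpa [pow_succ] using hd
        exact hqp.not_isUnit (isUnit_of_dvd_one
          ((mul_dvd_mul_iff_left (pow_ne_zero _ hqp.ne_zero)).mp this))
    | succ k hk ih => exact exists_unit_im_succ_of_odd hq hq2 (Or.inl hk) ih
  exact h.all_of_units hq (by norm_num) (fun k hk => h1 k (by omega)) hk

theorem UnitsCover.all_of_ramified_odd {M T : ℤ} {q : ℕ} (hq : q.Prime) (hq2 : Odd q)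
    (hD : (q : ℤ) ∣ T ^ 2 + 4 * M) (hD3 : q = 3 → (T ^ 2 + 4 * M) % 9 = 3)
    (h : UnitsCover M T q) {k : ℕ} (hk : 1 ≤ k) :
    UnitsCover M T ((q ^ k : ℕ) : ℤ) := by
  have hq2' : ¬ (q : ℤ) ∣ 2 := by
    intro h
    have h1 : q ∣ 2 := by exact_mod_cast h
    obtain rfl := (Nat.prime_dvd_prime_iff_eq hq Nat.prime_two).mp h1
    exact absurd hq2 (by decide)
  have h' : UnitsCover M T ((q ^ (0 + 1) : ℕ) : ℤ) := by simpa using h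
  have h1 : ∀ k, ∃ u : (QuadraticAlgebra ℤ M T)ˣ,
      (q : ℤ) ^ k ∣ (u : QuadraticAlgebra ℤ M T).im ∧
      ¬ (q : ℤ) ^ (k + 1) ∣ (u : QuadraticAlgebra ℤ M T).im := by
    intro k
    induction k with
    | zero =>
      -- This is `1 + δ` with `δ = 2ω - T`, of norm `1 - D ≡ 1` modulo `q`.
      refine UnitsCover.exists_unit_im h' (x := ⟨1 - T, 2⟩) ?_ (by simp) (by simpa using hq2')
      obtain ⟨l, hl⟩ := hD
      exact ⟨1, l, by rw [norm_def]; linear_combination -hl⟩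
    | succ k ih => exact exists_unit_im_succ_of_odd hq hq2 (Or.inr ⟨hD, hD3⟩) ih
  exact h'.all_of_units hq le_rfl (fun k _ => h1 k) hk

theorem UnitsCover.all_two (h : UnitsCover 2 0 2) {k : ℕ} (hk : 1 ≤ k) :
    UnitsCover 2 0 ((2 ^ k : ℕ) : ℤ) := by
  have h' : UnitsCover 2 0 ((2 ^ (0 + 1) : ℕ) : ℤ) := by simpa using h
  have h1 : ∀ k, ∃ u : (QuadraticAlgebra ℤ (2 : ℤ) 0)ˣ,
      (2 : ℤ) ^ k ∣ (u : QuadraticAlgebra ℤ (2 : ℤ) 0).im ∧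
      ¬ (2 : ℤ) ^ (k + 1) ∣ (u : QuadraticAlgebra ℤ (2 : ℤ) 0).im := by
    intro k
    induction k with
    | zero =>
      refine UnitsCover.exists_unit_im h' (x := ⟨1, 1⟩) ?_ (by simp) (by norm_num)
      exact ⟨1, 1, by rw [norm_def]; norm_num⟩
    | succ k ih => exact exists_unit_im_succ_two ih
  exact h'.all_of_units Nat.prime_two le_rfl (fun k _ => h1 k) hk

/-! ### Coverings for the moduli 2, 3 and 4. -/

theorem odd_of_isCoprime_two {n : ℤ} (h : IsCoprime n 2) : n % 2 = 1 := by
  have h1 := Int.prime_two.coprime_iff_not_dvd.mp h.symm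
  omega

/-- Here 2 splits, so `(O/2)ˣ` is trivial. -/
theorem unitsCover_two_of_even {M : ℤ} (hM : M % 2 = 0) : UnitsCover M 1 2 := by
  intro x hx
  have h1 := odd_of_isCoprime_two hx
  refine ⟨1, x.re, intCast_dvd_iff.mpr ⟨by simp, ?_⟩⟩
  simp only [Units.val_one, mul_one, im_sub, im_intCast, sub_zero]
  rw [norm_def] at h1
  by_contra h2
  have h3 : x.im % 2 = 1 := by omega
  rcases Int.emod_two_eq_zero_or_one x.re with h4 | h4 <;>
    simp [Int.add_emod, Int.sub_emod, Int.mul_emod, h3, h4, hM] at h1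

/-- Here 2 ramifies, so `(O/2)ˣ` has order 2; a unit with odd `b` is the nontrivial class. -/
theorem unitsCover_two_of_unit {M a b : ℤ} (h : IsUnit (a ^ 2 - M * b ^ 2)) (hb : b % 2 = 1) :
    UnitsCover M 0 2 := by
  intro x hx
  have h1 := odd_of_isCoprime_two hx
  rw [norm_def] at h1
  rcases Int.emod_two_eq_zero_or_one x.im with h3 | h3
  · exact ⟨1, x.re, intCast_dvd_iff.mpr ⟨by simp, by simpa using Int.dvd_of_emod_eq_zero h3⟩⟩
  · obtain ⟨u, hu⟩ := exists_unit (M := M) (T := 0) (a := a) (b := b) (by simpa using h)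
    refine ⟨u, 1, intCast_dvd_iff.mpr ⟨?_, ?_⟩⟩
    · have h2 : (a * a - M * b * b) % 2 = 1 := by
        rcases Int.isUnit_iff.mp h with h | h <;>
        · rw [show a * a - M * b * b = a ^ 2 - M * b ^ 2 by ring, h]; norm_num
      have h4 : (x.re - a) % 2 = 0 := by
        rcases Int.emod_two_eq_zero_or_one x.re with h5 | h5 <;>
        rcases Int.emod_two_eq_zero_or_one a with h6 | h6 <;>
        rcases Int.emod_two_eq_zero_or_one M with h7 | h7 <;>
          simp [Int.sub_emod, Int.mul_emod, h3, h5, h6, h7, hb] at h1 h2 ⊢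
      simpa [hu] using Int.dvd_of_emod_eq_zero h4
    · have h4 : (2 : ℤ) ∣ x.im - b := by omega
      simpa [hu] using h4

theorem UnitsCover.four_of_two {p : ℕ} (hp : p.Prime) (h4 : p % 4 = 1) {M : ℤ}
    (hM : (p : ℤ) = 4 * M + 1) (h : UnitsCover M 1 2) : UnitsCover M 1 4 := by
  obtain ⟨a, b, hab⟩ := exists_negative_pell hp (by omega)
  obtain ⟨ha, hb⟩ := negative_pell_parity h4 hab
  -- This is `a + b√p`, since `√p = 2ω - 1`. As `b` is odd, its `ω`-coefficient is exactly divisible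
  -- by 2.
  obtain ⟨u, hu⟩ := exists_unit (M := M) (T := 1) (a := a - b) (b := 2 * b) (by
    rw [show (a - b) ^ 2 + 1 * (a - b) * (2 * b) - M * (2 * b) ^ 2 = -1 by
      rw [← hab, hM]; ring]
    exact isUnit_one.neg)
  have h1 := UnitsCover.succ (k := 1) (η := u) Nat.prime_two le_rfl (by simpa using h)
    (by rw [hu]; simp) (by rw [hu]; obtain ⟨k, rfl⟩ := hb; push_cast; omega)
  simpa using h1

/-- `C_3` is cyclic of order 4 (inert) or 2 (split), and an element of norm `-1` generates it; the
four cases are its powers 0 to 3. -/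
theorem exists_eq_mul_pow_zmod_three : ∀ T M a b x y : ZMod 3, T ^ 2 + 4 * M ≠ 0 →
    a * a + T * a * b - M * b * b = -1 → x * x + T * x * y - M * y * y ≠ 0 →
    ∃ c : ZMod 3, (x = c ∧ y = 0) ∨ (x = c * a ∧ y = c * b) ∨
      (x = c * (a * a + M * b * b) ∧ y = c * (a * b + b * a + T * b * b)) ∨
      (x = c * ((a * a + M * b * b) * a + M * (a * b + b * a + T * b * b) * b) ∧
       y = c * ((a * a + M * b * b) * b + (a * b + b * a + T * b * b) * a +
        T * (a * b + b * a + T * b * b) * b)) := by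
  decide

theorem unitsCover_three {M T : ℤ} (hD : ¬ (3 : ℤ) ∣ T ^ 2 + 4 * M)
    {u : (QuadraticAlgebra ℤ M T)ˣ} (hu : norm (u : QuadraticAlgebra ℤ M T) = -1) :
    UnitsCover M T 3 := by
  have hz : ∀ n : ℤ, ((n : ℤ) : ZMod 3) = 0 ↔ (3 : ℤ) ∣ n := fun n =>
    ZMod.intCast_zmod_eq_zero_iff_dvd n 3
  intro x hx
  have hx3 := Int.prime_three.coprime_iff_not_dvd.mp hx.symm
  rw [← hz, norm_def] at hx3
  rw [← hz] at hD
  have hu3 := congrArg (Int.cast : ℤ → ZMod 3) hu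
  rw [norm_def] at hu3
  push_cast at hx3 hD hu3
  obtain ⟨c, hc⟩ := exists_eq_mul_pow_zmod_three _ _ _ _ _ _ hD hu3 hx3
  obtain ⟨c, rfl⟩ := ZMod.intCast_surjective c
  have key : ∀ v : QuadraticAlgebra ℤ M T, (x.re : ZMod 3) = c * v.re →
      (x.im : ZMod 3) = c * v.im → ((3 : ℤ) : QuadraticAlgebra ℤ M T) ∣ x - c * v := by
    intro v h1 h2
    refine intCast_dvd_iff.mpr ⟨?_, ?_⟩ <;> rw [← hz]
    · simp [h1]
    · simp [h2]
  rcases hc with ⟨h1, h2⟩ | ⟨h1, h2⟩ | ⟨h1, h2⟩ | ⟨h1, h2⟩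
  · exact ⟨1, c, key _ (by simpa using h1) (by simpa using h2)⟩
  · exact ⟨u, c, key _ h1 h2⟩
  · refine ⟨u * u, c, key _ ?_ ?_⟩
    · rw [h1, Units.val_mul, re_mul]; push_cast; rfl
    · rw [h2, Units.val_mul, im_mul]; push_cast; rfl
  · refine ⟨u * u * u, c, key _ ?_ ?_⟩
    · rw [h1]; simp only [Units.val_mul, re_mul, im_mul]; push_cast; rfl
    · rw [h2]; simp only [Units.val_mul, re_mul, im_mul]; push_cast; rfl

/-! ### Norm obstructions. -/

open Polynomial in
theorem exists_sq_sub_mul_sq_eq {q : ℕ} [Fact q.Prime] (hq : Odd q) {D : ZMod q} (hD : D ≠ 0)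
    (r : ZMod q) : ∃ x y : ZMod q, x ^ 2 - D * y ^ 2 = r := by
  have hf : degree (X ^ 2 - C r : (ZMod q)[X]) = 2 := degree_X_pow_sub_C (by norm_num) _
  have hg : degree (C (-D) * X ^ 2 : (ZMod q)[X]) = 2 := by
    rw [degree_C_mul_X_pow 2 (neg_ne_zero.mpr hD)]; rfl
  obtain ⟨a, b, hab⟩ := FiniteField.exists_root_sum_quadratic hf hg (by
    rw [ZMod.card]; exact Nat.odd_iff.mp hq)
  refine ⟨a, b, ?_⟩
  simp only [eval_sub, eval_pow, eval_X, eval_C, eval_mul] at hab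
  linear_combination hab

theorem not_unitsCover_of_isSquare {M T : ℤ} {q k : ℕ} (hq : q.Prime) (hq2 : Odd q) (hk : 1 ≤ k)
    (hD : ¬ (q : ℤ) ∣ T ^ 2 + 4 * M)
    (hu : ∀ u : (QuadraticAlgebra ℤ M T)ˣ,
      IsSquare ((norm (u : QuadraticAlgebra ℤ M T) : ℤ) : ZMod q)) :
    ¬ UnitsCover M T ((q ^ k : ℕ) : ℤ) := by
  intro h
  have h1 := h.of_prime_pow le_rfl hk
  rw [pow_one] at h1
  have : Fact q.Prime := ⟨hq⟩
  have hz : ∀ n : ℤ, ((n : ℤ) : ZMod q) = 0 ↔ (q : ℤ) ∣ n := fun n =>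
    ZMod.intCast_zmod_eq_zero_iff_dvd n q
  have hchar : ringChar (ZMod q) ≠ 2 := by
    rw [ZMod.ringChar_zmod_n]
    rintro rfl
    exact absurd hq2 (by decide)
  have h2 : (2 : ZMod q) ≠ 0 := Ring.two_ne_zero hchar
  obtain ⟨r, hr⟩ := FiniteField.exists_nonsquare hchar
  rw [← hz] at hD
  -- Completing the square, `4 N(x + yω) = (2x + Ty)² - D y²`, so a nonsquare `r` is a norm.
  obtain ⟨X, Y, hXY⟩ := exists_sq_sub_mul_sq_eq hq2 hD (4 * r)
  obtain ⟨y, rfl⟩ := ZMod.intCast_surjective Y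
  obtain ⟨x, hx⟩ := ZMod.intCast_surjective ((X - (T : ZMod q) * (y : ZMod q)) / 2)
  have hX : X = 2 * x + T * y := by rw [hx]; field_simp; ring
  have hN : ((norm (⟨x, y⟩ : QuadraticAlgebra ℤ M T) : ℤ) : ZMod q) = r := by
    rw [norm_def]
    push_cast at hXY ⊢
    rw [hX] at hXY
    have h4 : (4 : ZMod q) ≠ 0 := by
      rw [show (4 : ZMod q) = 2 * 2 by norm_num]; exact mul_ne_zero h2 h2
    apply mul_left_cancel₀ h4
    linear_combination hXY
  have hcop : IsCoprime (norm (⟨x, y⟩ : QuadraticAlgebra ℤ M T)) (q : ℤ) := by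
    rw [isCoprime_comm, (Nat.prime_iff_prime_int.mp hq).coprime_iff_not_dvd, ← hz, hN]
    rintro rfl
    exact hr (IsSquare.zero)
  obtain ⟨u, c, huc⟩ := h1 _ hcop
  have h3 := (hz _).mpr (intCast_dvd_norm_sub huc)
  rw [map_mul, norm_intCast, Int.cast_sub, hN, sub_eq_zero] at h3
  apply hr
  rw [h3]
  push_cast
  exact (IsSquare.sq _).mul (hu u)

theorem Int.sq_emod_eight_of_odd {c : ℤ} (hc : c % 2 = 1) : c ^ 2 % 8 = 1 := by
  have h : c % 8 = 1 ∨ c % 8 = 3 ∨ c % 8 = 5 ∨ c % 8 = 7 := by omega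
  rcases h with h | h | h | h <;> simp [pow_two, Int.mul_emod, h]

/-- The element `1 + 2ω` has norm `1 - 4M ≡ 5` modulo 8. As `T = 0`, changing it by a multiple of 4
preserves the norm modulo 8, so it cannot be congruent to `c u`. -/
theorem not_unitsCover_four {M : ℤ} (hM : M % 2 = 1) : ¬ UnitsCover M 0 4 := by
  intro h
  obtain ⟨u, c, hu⟩ := h ⟨1, 2⟩ (by
    rw [norm_def]
    exact ⟨1, M, by ring⟩)
  obtain ⟨⟨m, hm⟩, n, hn⟩ := intCast_dvd_iff.mp hu
  have hN := norm_unit u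
  rw [norm_def] at hN
  simp only [re_sub, im_sub, re_mul, im_mul, re_intCast, im_intCast, Int.cast_id, mul_zero,
    zero_mul, add_zero] at hm hn
  generalize (u : QuadraticAlgebra ℤ M 0).re = a at *
  generalize (u : QuadraticAlgebra ℤ M 0).im = b at *
  have hc : c % 2 = 1 := by
    by_contra hc
    obtain ⟨d, rfl⟩ : ∃ d, c = 2 * d := ⟨c / 2, by omega⟩
    rw [mul_assoc] at hm
    omega
  have hc2 := Int.sq_emod_eight_of_odd hc
  obtain ⟨k, rfl⟩ : ∃ k, M = 2 * k + 1 := ⟨M / 2, by omega⟩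
  have h1 : c ^ 2 * (a * a + 0 * a * b - (2 * k + 1) * b * b) =
      8 * (-m + 2 * m ^ 2 - k + (2 * k + 1) * (2 * n - 2 * n ^ 2)) - 3 := by
    linear_combination (-(c * a) - (1 - 4 * m)) * hm +
      ((2 * k + 1) * ((c * b) + (2 - 4 * n))) * hn
  generalize -m + 2 * m ^ 2 - k + (2 * k + 1) * (2 * n - 2 * n ^ 2) = t at h1
  rcases hN with hN | hN <;> rw [hN] at h1 <;> omega

theorem not_unitsCover_eight {M : ℤ} : ¬ UnitsCover M 1 8 := by
  intro h
  have hN1 : norm (⟨1, 4⟩ : QuadraticAlgebra ℤ M 1) = 8 * (1 - 2 * M) - 3 := by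
    rw [norm_def]; ring
  obtain ⟨u, c, hu⟩ := h ⟨1, 4⟩ (by
    rw [hN1]
    exact ⟨-3, 3 * (1 - 2 * M) - 1, by ring⟩)
  obtain ⟨n, hn⟩ := intCast_dvd_norm_sub hu
  rw [map_mul, norm_intCast, Int.cast_id, hN1] at hn
  have hc : c % 2 = 1 := by
    by_contra hc
    obtain ⟨d, rfl⟩ : ∃ d, c = 2 * d := ⟨c / 2, by omega⟩
    rw [show (2 * d) ^ 2 * norm (u : QuadraticAlgebra ℤ M 1) =
      4 * (d ^ 2 * norm (u : QuadraticAlgebra ℤ M 1)) by ring] at hn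
    omega
  have hc2 := Int.sq_emod_eight_of_odd hc
  rcases norm_unit u with hN | hN <;> rw [hN] at hn <;> omega

theorem isSquare_norm_unit_of_mod_four_eq_three {p q : ℕ} (hp : p % 4 = 3)
    (u : (QuadraticAlgebra ℤ (p : ℤ) 0)ˣ) :
    IsSquare ((norm (u : QuadraticAlgebra ℤ (p : ℤ) 0) : ℤ) : ZMod q) := by
  rcases norm_unit u with h | h
  · rw [h]; simp
  · exfalso
    rw [norm_def] at h
    generalize (u : QuadraticAlgebra ℤ (p : ℤ) 0).re = a at h
    generalize (u : QuadraticAlgebra ℤ (p : ℤ) 0).im = b at h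
    obtain ⟨c, hc⟩ : ∃ c : ℤ, (p : ℤ) = 4 * c + 3 := ⟨p / 4, by omega⟩
    rw [hc] at h
    rcases Int.even_or_odd a with ⟨l, rfl⟩ | ⟨l, rfl⟩ <;>
    rcases Int.even_or_odd b with ⟨k, rfl⟩ | ⟨k, rfl⟩ <;> ring_nf at h <;> omega

theorem isSquare_norm_unit_of_mod_four_eq_one {M T : ℤ} {q : ℕ} (hq : q.Prime) (h4 : q % 4 = 1)
    (u : (QuadraticAlgebra ℤ M T)ˣ) :
    IsSquare ((norm (u : QuadraticAlgebra ℤ M T) : ℤ) : ZMod q) := by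
  have : Fact q.Prime := ⟨hq⟩
  rcases norm_unit u with h | h
  · rw [h]; simp
  · rw [h]
    push_cast
    exact ZMod.exists_sq_eq_neg_one_iff.mpr (by omega)

/-! ### Assembly. -/

theorem not_dvd_four_mul_prime {p q : ℕ} (hp : p.Prime) (hq : q.Prime) (hq2 : Odd q)
    (hqp : q ≠ p) : ¬ (q : ℤ) ∣ 4 * p := by
  intro h
  have h1 : q ∣ 4 * p := by exact_mod_cast h
  rcases hq.dvd_mul.mp h1 with h2 | h2
  · have h3 : q ∣ 2 := hq.dvd_of_dvd_pow (show q ∣ 2 ^ 2 by simpa using h2)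
    obtain rfl := (Nat.prime_dvd_prime_iff_eq hq Nat.prime_two).mp h3
    exact absurd hq2 (by decide)
  · exact hqp ((Nat.prime_dvd_prime_iff_eq hq hp).mp h2)

/-- The generator of the ring of integers of `ℚ(√p)` satisfies `ω ^ 2 = M + T ω` with
discriminant `T ^ 2 + 4 * M` equal to `p` or `4 * p`. -/
theorem exists_isLocallyAssociated_quadOrder_iff {K : Type*} [Field K] [NumberField K] {p : ℕ}
    (hp : p.Prime) {s : K} (hs : s ^ 2 = ((p : ℤ) : K))
    (hK : IntermediateField.adjoin ℚ {s} = ⊤) :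
    ∃ M T : ℤ, (p % 4 = 1 ∧ T = 1 ∧ (p : ℤ) = 4 * M + 1 ∨ p % 4 ≠ 1 ∧ T = 0 ∧ M = p) ∧
      ∀ n : ℕ, 1 ≤ n → (IsLocallyAssociated (quadOrder p s hs n) ↔ UnitsCover M T n) := by
  by_cases h4 : p % 4 = 1
  · obtain ⟨M, hM⟩ : ∃ M : ℤ, (p : ℤ) = 4 * M + 1 := ⟨p / 4, by omega⟩
    obtain ⟨e, he⟩ := exists_ringEquiv_of_mod_four_eq_one hp h4 hs hK hM
    exact ⟨M, 1, Or.inl ⟨h4, rfl, hM⟩, fun n hn => isLocallyAssociated_quadOrder_iff e he hn⟩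
  · obtain ⟨e, he⟩ := exists_ringEquiv_of_mod_four_ne_one hp h4 hs hK
    exact ⟨p, 0, Or.inr ⟨h4, rfl, rfl⟩, fun n hn => isLocallyAssociated_quadOrder_iff e he hn⟩

theorem mainTheorem1 {K : Type*} [Field K] [NumberField K] (p : ℕ) (hp : p.Prime)
    (s : K) (hs : s ^ 2 = ((p : ℤ) : K)) (hK : IntermediateField.adjoin ℚ {s} = ⊤) :
    -- (1), (2), (3): locally associated
    (p % 8 ≠ 5 → IsLocallyAssociated (quadOrder p s hs 2)) ∧
    (p % 8 = 1 → IsLocallyAssociated (quadOrder p s hs 4)) ∧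
    (p % 4 ≠ 3 → IsLocallyAssociated (quadOrder p s hs 3)) ∧
    -- (4), (5), (6): conditionally locally associated
    ((∀ k : ℕ, 1 ≤ k → IsLocallyAssociated (quadOrder p s hs (p ^ k))) ↔
      IsLocallyAssociated (quadOrder p s hs p)) ∧
    (p % 8 = 5 →
      (IsLocallyAssociated (quadOrder p s hs 4) ↔ IsLocallyAssociated (quadOrder p s hs 2))) ∧
    (∀ q : ℕ, q.Prime → Odd q → q ≠ p →
      ((∀ k : ℕ, 1 ≤ k → IsLocallyAssociated (quadOrder p s hs (q ^ k))) ↔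
        IsLocallyAssociated (quadOrder p s hs (q ^ 2)))) ∧
    -- (7), (8), (9): not locally associated
    (∀ q k : ℕ, q.Prime → Odd q → q ≠ p → 1 ≤ k → (p % 4 = 3 ∨ q % 4 = 1) →
      ¬ IsLocallyAssociated (quadOrder p s hs (q ^ k))) ∧
    (p % 4 = 3 → ¬ IsLocallyAssociated (quadOrder p s hs 4)) ∧
    (Odd p → ¬ IsLocallyAssociated (quadOrder p s hs 8)) := by
  obtain ⟨M, T, hMT, hLA⟩ := exists_isLocallyAssociated_quadOrder_iff hp hs hK
  have hD : (T ^ 2 + 4 * M) ∣ 4 * (p : ℤ) ∧ (p : ℤ) ∣ T ^ 2 + 4 * M := by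
    rcases hMT with ⟨-, rfl, h⟩ | ⟨-, rfl, h⟩
    · exact ⟨⟨4, by linear_combination 4 * h⟩, ⟨1, by linear_combination -h⟩⟩
    · exact ⟨⟨1, by linear_combination -4 * h⟩, ⟨4, by linear_combination 4 * h⟩⟩
  have hDq : ∀ q : ℕ, q.Prime → Odd q → q ≠ p → ¬ (q : ℤ) ∣ T ^ 2 + 4 * M :=
    fun q hq hq2 hqp h => not_dvd_four_mul_prime hp hq hq2 hqp (h.trans hD.1)
  have h42 : UnitsCover M T 4 → UnitsCover M T 2 := fun h =>
    UnitsCover.of_prime_pow (q := 2) (j := 1) (k := 2) le_rfl (by norm_num) h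
  have h84 : UnitsCover M T 8 → UnitsCover M T 4 := fun h =>
    UnitsCover.of_prime_pow (q := 2) (j := 2) (k := 3) (by norm_num) (by norm_num) h
  have h24 : p % 4 = 1 → UnitsCover M T 2 → UnitsCover M T 4 := by
    intro h4
    rcases hMT with ⟨-, rfl, h⟩ | ⟨h, -⟩
    · exact UnitsCover.four_of_two hp h4 h
    · exact absurd h4 h
  have h2 : p % 8 ≠ 5 → UnitsCover M T 2 := by
    intro h8
    rcases hMT with ⟨h4, rfl, h⟩ | ⟨h4, rfl, rfl⟩
    · exact unitsCover_two_of_even (by omega)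
    · rcases hp.eq_two_or_odd with rfl | hp2
      · exact unitsCover_two_of_unit (a := 1) (b := 1) (by norm_num) (by norm_num)
      · obtain ⟨a, b, hab, hb⟩ := exists_pell_odd hp (by omega)
        exact unitsCover_two_of_unit (a := a) (b := b) (by rw [hab]; exact isUnit_one)
          (Int.odd_iff.mp hb)
  have hpk : ∀ n k : ℕ, n.Prime → 1 ≤ n ^ k := fun n k hn => Nat.one_le_pow _ _ hn.pos
  refine ⟨fun h => (hLA 2 (by norm_num)).mpr (h2 h), fun h => (hLA 4 (by norm_num)).mpr ?_,
    fun h => (hLA 3 (by norm_num)).mpr ?_, ⟨fun h => by simpa using h 1 le_rfl, fun h k hk => ?_⟩,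
    fun h => ?_, fun q hq hq2 hqp => ⟨fun h => h 2 (by norm_num), fun h k hk => ?_⟩,
    fun q k hq hq2 hqp hk h => ?_, fun h => ?_, fun h => ?_⟩
  · exact h24 (by omega) (h2 (by omega))
  · have h3 := hDq 3 Nat.prime_three (by decide) (by rintro rfl; norm_num at h)
    obtain ⟨a, b, hab⟩ := exists_negative_pell hp h
    obtain ⟨u, hu⟩ : ∃ u : (QuadraticAlgebra ℤ M T)ˣ,
        norm (u : QuadraticAlgebra ℤ M T) = -1 := by
      rcases hMT with ⟨h4, rfl, hM⟩ | ⟨h4, rfl, rfl⟩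
      · have h5 : (a - b) ^ 2 + 1 * (a - b) * (2 * b) - M * (2 * b) ^ 2 = -1 := by
          rw [← hab, hM]; ring
        obtain ⟨u, hu⟩ := exists_unit (M := M) (T := 1) (h5 ▸ isUnit_one.neg)
        refine ⟨u, ?_⟩
        rw [hu, norm_def, ← h5]; ring
      · have h5 : a ^ 2 + 0 * a * b - p * b ^ 2 = -1 := by rw [← hab]; ring
        obtain ⟨u, hu⟩ := exists_unit (M := (p : ℤ)) (T := 0) (h5 ▸ isUnit_one.neg)
        refine ⟨u, ?_⟩
        rw [hu, norm_def, ← h5]; ring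
    exact unitsCover_three h3 hu
  · rw [hLA _ (hpk _ _ hp)]
    rw [hLA _ hp.one_lt.le] at h
    rcases hp.eq_two_or_odd' with rfl | hp2
    · obtain ⟨-, rfl, rfl⟩ := hMT.resolve_left (by norm_num)
      exact UnitsCover.all_two h hk
    · refine UnitsCover.all_of_ramified_odd hp hp2 hD.2 ?_ h hk
      -- For `p = 3` the discriminant is 12, which is 3 modulo 9.
      rintro rfl
      obtain ⟨-, rfl, rfl⟩ := hMT.resolve_left (by norm_num)
      norm_num
  · rw [hLA 4 (by norm_num), hLA 2 (by norm_num)]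
    exact ⟨h42, h24 (by omega)⟩
  · rw [hLA _ (hpk _ _ hq)] at h ⊢
    exact h.all_of_sq hq hq2 hk
  · rw [hLA _ (hpk _ _ hq)]
    refine not_unitsCover_of_isSquare hq hq2 hk (hDq q hq hq2 hqp) fun u => ?_
    rcases h with h | h
    · obtain ⟨-, rfl, rfl⟩ := hMT.resolve_left (by omega)
      exact isSquare_norm_unit_of_mod_four_eq_three h u
    · exact isSquare_norm_unit_of_mod_four_eq_one hq h u
  · rw [hLA 4 (by norm_num)]
    obtain ⟨-, rfl, rfl⟩ := hMT.resolve_left (by omega)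
    exact not_unitsCover_four (by omega)
  · rw [hLA 8 (by norm_num)]
    rcases hMT with ⟨h4, rfl, hM⟩ | ⟨h4, rfl, rfl⟩
    · exact not_unitsCover_eight
    · intro h8
      have := Nat.odd_iff.mp h
      -- For `p ≡ 3` modulo 4 the failure at 4 already rules out 8.
      exact not_unitsCover_four (by omega) (h84 h8)
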